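/- Let $S$ be an inverse semigroup with its natural partial order $\le$; a zero of $S$ means a least element (it need not exist). Elements $s,t$ are compatible if $s^{-1}t$ and $st^{-1}$ are idempotents. A (proper) filter of $S$ is a non-empty, down-directed, upwardly closed subset of $S$ that does not contain a zero. The filters of $S$ form a groupoid: with $\mathbf d(A)=(A^{-1}A)^{\uparrow}$ and $\mathbf r(A)=(AA^{-1})^{\uparrow}$, the product $A\cdot B=(AB)^{\uparrow}$ is defined iff $\mathbf d(A)=\mathbf r(B)$, and the inverse of $A$ is $A^{-1}$. Paterson's universal groupoid $\mathsf G_u(S)$ is this groupoid with the patch topology, generated by the sets $\{A : x\in A,\ x_1,\dots,x_n\notin A\}$ with $n\ge 0$ and $x_1,\dots,x_n\le x$ in $S$. An inverse semigroup $T$ is distributive if its finite compatible subsets (including $\emptyset$) have joins and multiplication distributes over the finite joins that exist; it is weakly boolean if moreover its idempotents form a (generalized) boolean algebra; it is an inverse $\wedge$-semigroup if all binary meets exist. For $T$ distributive, $\mathsf G_P(T)$ is the subgroupoid of prime filters ($a\vee b\in P$ implies $a\in P$ or $b\in P$), with the topology generated by the sets $Y_s=\{P: s\in P\}$, $s\in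 T$. The weak booleanization of $\mathsf G_P(T)$ is the same groupoid with the patch topology, generated by the sets $Y_s\setminus Y_t$ with $t\le s$; when $T$ is also an inverse $\wedge$-semigroup it is called the booleanization of $\mathsf G_P(T)$. Let $\mathsf D(S)$ be the distributive inverse semigroup of finite elements of the pseudogroup of compatible order ideals of $S$ (order ideals contain the zero of $S$ if there is one) under subset multiplication, an element $a$ being finite if $a\le\bigvee X$ with $X$ compatible implies $a\le\bigvee Y$ for some finite $Y\subseteq X$. Let $\mathsf B(S)=\mathsf{KB}(\mathsf G_u(S))$ be the inverse semigroup of compact-open bisections of $\mathsf G_u(S)$ under subset multiplication. **Theorem 5.6 (First booleanization).** 1. $\mathsf G_u(S)$ is isomorphic, as a topological groupoid, to the weak booleanization of $\mathsf G_P(\mathsf D(S))$. In particular, the inverse semigroup $\mathsf B(S)$ is weakly boolean and $\mathsf G_u(S)$ is isomorphic, as a topological groupoid, to $\mathsf G_P(\mathsf B(S))$. 2. If $S$ satisfies the weak meet condition (the intersection of any two principal order ideals is a finitely generated order ideal), then this weak booleanization is a booleanization: $\mathsf D(S)$ is an inverse $\wedge$-semigroup, and $\mathsf G_P(\mathsf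 D(S))$ with the patch topology is a boolean groupoid, i.e. a Hausdorff étale groupoid with a basis of compact-open bisections whose space of identities is a boolean space (Hausdorff with a basis of compact-open sets). -/

import Mathlib

namespace NCStone

universe u

/-- An inverse semigroup: every element `a` has exactly one generalized inverse, namely `a⁻¹`. -/
class InverseSemigroup (S : Type u) extends Semigroup S, Inv S where
  mul_inv_mul : ∀ a : S, a * a⁻¹ * a = a
  inv_mul_inv : ∀ a : S, a⁻¹ * a * a⁻¹ = a⁻¹
  eq_inv : ∀ a b : S, a * b * a = a → b * a * b = b → b = a⁻¹

/-- Idempotent elements. -/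
def IsIdem {S : Type u} [InverseSemigroup S] (e : S) : Prop := e * e = e

section basic

variable {S : Type u} [InverseSemigroup S]

open InverseSemigroup

theorem inv_inv' (a : S) : a⁻¹⁻¹ = a :=
  (eq_inv a⁻¹ a (inv_mul_inv a) (mul_inv_mul a)).symm

theorem IsIdem.inv_eq {e : S} (he : IsIdem e) : e⁻¹ = e := by
  have h : e * e = e := he
  exact (eq_inv e e (by rw [h, h]) (by rw [h, h])).symm

theorem isIdem_inv_mul (a : S) : IsIdem (a⁻¹ * a) := by
  unfold IsIdem; rw [← mul_assoc, inv_mul_inv]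

theorem isIdem_mul_inv (a : S) : IsIdem (a * a⁻¹) := by
  unfold IsIdem; rw [← mul_assoc, mul_inv_mul]

theorem IsIdem.mul {e f : S} (he : IsIdem e) (hf : IsIdem f) : IsIdem (e * f) := by
  have he' : e * e = e := he
  have hf' : f * f = f := hf
  have h1 := mul_inv_mul (e * f)
  have h2 := inv_mul_inv (e * f)
  have hx : f * (e * f)⁻¹ * e = (e * f)⁻¹ := by
    apply eq_inv
    · grind
    · grind
  have hid : IsIdem (e * f)⁻¹ := by
    unfold IsIdem
    generalize (e * f)⁻¹ = x at *
    calc x * x = (f * x * e) * (f * x * e) := by rw [hx]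
      _ = f * (x * (e * f) * x) * e := by simp only [mul_assoc]
      _ = x := by rw [h2, hx]
  have := hid.inv_eq
  rw [inv_inv'] at this
  rw [this]; exact hid

theorem IsIdem.comm {e f : S} (he : IsIdem e) (hf : IsIdem f) : e * f = f * e := by
  have he' : e * e = e := he
  have hf' : f * f = f := hf
  have h1 : (e * f) * (e * f) = e * f := he.mul hf
  have h2 : (f * e) * (f * e) = f * e := hf.mul he
  have := eq_inv (e * f) (f * e) (by grind) (by grind)
  rw [this, (he.mul hf).inv_eq]

theorem mul_inv_rev' (a b : S) : (a * b)⁻¹ = b⁻¹ * a⁻¹ := by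
  have hc : (b * b⁻¹) * (a⁻¹ * a) = (a⁻¹ * a) * (b * b⁻¹) :=
    (isIdem_mul_inv b).comm (isIdem_inv_mul a)
  have h1 := mul_inv_mul a
  have h2 := mul_inv_mul b
  have h3 := inv_mul_inv a
  have h4 := inv_mul_inv b
  symm
  apply eq_inv
  · calc a * b * (b⁻¹ * a⁻¹) * (a * b) = a * ((b * b⁻¹) * (a⁻¹ * a)) * b := by
          simp only [mul_assoc]
      _ = (a * a⁻¹ * a) * (b * b⁻¹ * b) := by rw [hc]; simp only [mul_assoc]
      _ = a * b := by rw [h1, h2]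
  · calc b⁻¹ * a⁻¹ * (a * b) * (b⁻¹ * a⁻¹) = b⁻¹ * ((a⁻¹ * a) * (b * b⁻¹)) * a⁻¹ := by
          simp only [mul_assoc]
      _ = (b⁻¹ * b * b⁻¹) * (a⁻¹ * a * a⁻¹) := by rw [← hc]; simp only [mul_assoc]
      _ = b⁻¹ * a⁻¹ := by rw [h3, h4]

theorem IsIdem.conj {e : S} (he : IsIdem e) (a : S) : IsIdem (a⁻¹ * e * a) := by
  have he' : e * e = e := he
  have hc := he.comm (isIdem_mul_inv a)
  calc a⁻¹ * e * a * (a⁻¹ * e * a) = a⁻¹ * (e * (a * a⁻¹)) * (e * a) := by simp only [mul_assoc]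
    _ = (a⁻¹ * a * a⁻¹) * (e * e) * a := by rw [hc]; simp only [mul_assoc]
    _ = a⁻¹ * e * a := by rw [inv_mul_inv, he']

theorem eq_mul_inv_mul_of {a b e : S} (he : IsIdem e) (h : a = b * e) : a = b * (a⁻¹ * a) := by
  have he' : e * e = e := he
  have hc := he.comm (isIdem_inv_mul b)
  have : a⁻¹ * a = (b⁻¹ * b) * e := by
    rw [h, mul_inv_rev', he.inv_eq]
    calc e * b⁻¹ * (b * e) = (e * (b⁻¹ * b)) * e := by simp only [mul_assoc]
      _ = (b⁻¹ * b) * (e * e) := by rw [hc]; simp only [mul_assoc]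
      _ = _ := by rw [he']
  rw [this, ← mul_assoc, ← mul_assoc, mul_inv_mul, h]

/-- The natural partial order: `a ≤ b` iff `a = b * e` for some idempotent `e`. -/
instance naturalOrder : PartialOrder S where
  le a b := ∃ e : S, IsIdem e ∧ a = b * e
  le_refl a := ⟨a⁻¹ * a, isIdem_inv_mul a, by rw [← mul_assoc, mul_inv_mul]⟩
  le_trans a b c := by
    rintro ⟨e, he, rfl⟩ ⟨f, hf, rfl⟩
    exact ⟨f * e, hf.mul he, mul_assoc _ _ _⟩
  le_antisymm a b := by
    rintro ⟨e, he, h⟩ ⟨f, hf, h'⟩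
    have h1 := eq_mul_inv_mul_of he h
    have h2 := eq_mul_inv_mul_of hf h'
    calc a = b * (a⁻¹ * a) := h1
      _ = a * (b⁻¹ * b) * (a⁻¹ * a) := by rw [← h2]
      _ = a * ((b⁻¹ * b) * (a⁻¹ * a)) := mul_assoc _ _ _
      _ = a * ((a⁻¹ * a) * (b⁻¹ * b)) := by rw [(isIdem_inv_mul b).comm (isIdem_inv_mul a)]
      _ = (a * a⁻¹ * a) * (b⁻¹ * b) := by simp only [mul_assoc]
      _ = b := by rw [mul_inv_mul, ← h2]

theorem le_def {a b : S} : a ≤ b ↔ ∃ e : S, IsIdem e ∧ a = b * e := Iff.rfl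

theorem le_iff_right {a b : S} : a ≤ b ↔ a = b * (a⁻¹ * a) :=
  ⟨fun ⟨_, he, h⟩ => eq_mul_inv_mul_of he h, fun h => ⟨_, isIdem_inv_mul a, h⟩⟩

theorem mul_idem_le (a : S) {e : S} (he : IsIdem e) : a * e ≤ a := ⟨e, he, rfl⟩

theorem idem_mul_le (a : S) {e : S} (he : IsIdem e) : e * a ≤ a :=
  ⟨a⁻¹ * e * a, he.conj a, by
    calc e * a = e * (a * a⁻¹ * a) := by rw [mul_inv_mul]
      _ = (e * (a * a⁻¹)) * a := by simp only [mul_assoc]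
      _ = a * (a⁻¹ * e * a) := by rw [he.comm (isIdem_mul_inv a)]; simp only [mul_assoc]⟩

theorem inv_le_inv' {a b : S} (h : a ≤ b) : a⁻¹ ≤ b⁻¹ := by
  obtain ⟨e, he, rfl⟩ := h
  rw [mul_inv_rev', he.inv_eq]
  exact idem_mul_le _ he

theorem inv_le_iff {a b : S} : a⁻¹ ≤ b ↔ a ≤ b⁻¹ :=
  ⟨fun h => by simpa [inv_inv'] using inv_le_inv' h, fun h => by simpa [inv_inv'] using inv_le_inv' h⟩

theorem mul_le_mul_both {a b c d : S} (h : a ≤ b) (h' : c ≤ d) : a * c ≤ b * d := by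
  obtain ⟨e, he, rfl⟩ := h
  obtain ⟨f, hf, rfl⟩ := h'
  calc b * e * (d * f) = (b * (e * d)) * f := by simp only [mul_assoc]
    _ ≤ b * (e * d) := mul_idem_le _ hf
    _ ≤ b * d := by
      obtain ⟨g, hg, h⟩ := idem_mul_le d he
      rw [h, ← mul_assoc]
      exact mul_idem_le _ hg

theorem le_iff_left {a b : S} : a ≤ b ↔ a = (a * a⁻¹) * b := by
  constructor
  · intro h
    have := le_iff_right.1 (inv_le_inv' h)
    rw [inv_inv'] at this
    have h2 := congrArg (·⁻¹) this
    simpa [inv_inv', mul_inv_rev', mul_assoc] using h2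
  · intro h
    rw [h]; exact idem_mul_le _ (isIdem_mul_inv a)

theorem IsIdem.of_le {a e : S} (he : IsIdem e) (h : a ≤ e) : IsIdem a := by
  obtain ⟨f, hf, rfl⟩ := h
  exact he.mul hf

theorem inv_mul_le {a b : S} (h : a ≤ b) : a⁻¹ * a ≤ b⁻¹ * b := mul_le_mul_both (inv_le_inv' h) h

theorem isIdem_of_isBot {z : S} (hz : IsBot z) : IsIdem z :=
  (isIdem_inv_mul z).of_le (hz _)

theorem isBot_mul_left {z : S} (hz : IsBot z) (s : S) : s * z = z := by
  have h := le_iff_right.1 (hz s)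
  have hi := isIdem_of_isBot hz
  rw [hi.inv_eq] at h
  have hi' : z * z = z := hi
  rw [hi'] at h; exact h.symm

theorem isBot_mul_right {z : S} (hz : IsBot z) (s : S) : z * s = z := by
  have h := le_iff_left.1 (hz s)
  have hi := isIdem_of_isBot hz
  rw [hi.inv_eq] at h
  have hi' : z * z = z := hi
  rw [hi'] at h; exact h.symm

/-- Elements `s`, `t` are compatible if `s⁻¹t` and `st⁻¹` are idempotents. -/
def Compatible (s t : S) : Prop := IsIdem (s⁻¹ * t) ∧ IsIdem (s * t⁻¹)

/-- A set of pairwise compatible elements. -/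
def CompatibleSet (A : Set S) : Prop := ∀ a ∈ A, ∀ b ∈ A, Compatible a b

theorem Compatible.symm {s t : S} (h : Compatible s t) : Compatible t s := by
  have h1 := h.1.inv_eq
  have h2 := h.2.inv_eq
  rw [mul_inv_rev', inv_inv'] at h1 h2
  exact ⟨by rw [h1]; exact h.1, by rw [h2]; exact h.2⟩

theorem Compatible.of_le {s t a b : S} (h : Compatible a b) (hs : s ≤ a) (ht : t ≤ b) :
    Compatible s t :=
  ⟨h.1.of_le (mul_le_mul_both (inv_le_inv' hs) ht), h.2.of_le (mul_le_mul_both hs (inv_le_inv' ht))⟩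

theorem compatible_self (a : S) : Compatible a a := ⟨isIdem_inv_mul a, isIdem_mul_inv a⟩

/-- The weak meet condition: the intersection of any two principal order ideals is finitely
generated as an order ideal. -/
def WeakMeetCondition (S : Type u) [InverseSemigroup S] : Prop :=
  ∀ a b : S, ∃ F : Set S, F.Finite ∧ Set.Iic a ∩ Set.Iic b = {x | ∃ f ∈ F, x ≤ f}

/-- An inverse `∧`-semigroup: all binary meets exist. -/
def IsMeetSemigroup (S : Type u) [InverseSemigroup S] : Prop :=
  ∀ a b : S, ∃ m : S, IsGLB {a, b} m

/-- A distributive inverse semigroup: finite compatible subsets have joins, and multiplication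
distributes over the finite joins that exist. The empty set is included, so there is a zero. -/
class IsDistributive (S : Type u) [InverseSemigroup S] : Prop where
  exists_join : ∀ A : Set S, A.Finite → CompatibleSet A → ∃ j, IsLUB A j
  mul_join : ∀ (A : Set S) (j s : S), A.Finite → IsLUB A j → IsLUB ((fun a => s * a) '' A) (s * j)
  join_mul : ∀ (A : Set S) (j s : S), A.Finite → IsLUB A j → IsLUB ((fun a => a * s) '' A) (j * s)

/-- A weakly boolean inverse semigroup: a distributive inverse semigroup whose idempotents form a
(generalized) boolean algebra. Since the idempotents of a distributive inverse semigroup form a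
distributive lattice with zero, this says that each idempotent `f ≤ e` has a complement `g`
relative to `e`. -/
def IsWeaklyBoolean (S : Type u) [InverseSemigroup S] : Prop :=
  IsDistributive S ∧ ∀ e f : S, IsIdem e → f ≤ e →
    ∃ g : S, g ≤ e ∧ IsLUB {f, g} e ∧ IsBot (f * g)

end basic

/-- A semigroup with a regular involution-like operation whose idempotents commute is inverse. -/
theorem eq_inv_of_comm {S : Type u} [Semigroup S] [Inv S]
    (h1 : ∀ a : S, a * a⁻¹ * a = a) (h2 : ∀ a : S, a⁻¹ * a * a⁻¹ = a⁻¹)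
    (hc : ∀ e f : S, e * e = e → f * f = f → e * f = f * e)
    (a b : S) (hab : a * b * a = a) (hba : b * a * b = b) : b = a⁻¹ := by
  have i1 : (b * a) * (b * a) = b * a := by rw [← mul_assoc, hba]
  have i2 : (a⁻¹ * a) * (a⁻¹ * a) = a⁻¹ * a := by rw [← mul_assoc, h2]
  have i3 : (a * b) * (a * b) = a * b := by rw [← mul_assoc, hab]
  have i4 : (a * a⁻¹) * (a * a⁻¹) = a * a⁻¹ := by rw [← mul_assoc, h1]
  have e1 : b * a = a⁻¹ * a := by
    calc b * a = b * (a * a⁻¹ * a) := by rw [h1]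
      _ = (b * a) * (a⁻¹ * a) := by simp only [mul_assoc]
      _ = (a⁻¹ * a) * (b * a) := hc _ _ i1 i2
      _ = a⁻¹ * (a * b * a) := by simp only [mul_assoc]
      _ = a⁻¹ * a := by rw [hab]
  have e2 : a * b = a * a⁻¹ := by
    calc a * b = (a * a⁻¹ * a) * b := by rw [h1]
      _ = (a * a⁻¹) * (a * b) := by simp only [mul_assoc]
      _ = (a * b) * (a * a⁻¹) := hc _ _ i4 i3
      _ = (a * b * a) * a⁻¹ := by simp only [mul_assoc]
      _ = a * a⁻¹ := by rw [hab]
  calc b = b * a * b := hba.symm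
    _ = a⁻¹ * (a * b) := by rw [e1, mul_assoc]
    _ = a⁻¹ * a * a⁻¹ := by rw [e2, mul_assoc]
    _ = a⁻¹ := h2 a

/-- A groupoid in the arrows-only sense: a set with a partially defined multiplication
(`comp x y` exists when `Composable x y`) and an involution. -/
class ArrowGroupoid (G : Type u) extends Inv G where
  Composable : G → G → Prop
  comp : (x y : G) → Composable x y → G
  inv_invol : ∀ x : G, x⁻¹⁻¹ = x
  comp_assoc : ∀ (x y z : G) (h : Composable x y) (h' : Composable y z),
    ∃ (k : Composable (comp x y h) z) (k' : Composable x (comp y z h')),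
      comp (comp x y h) z k = comp x (comp y z h') k'
  inv_composable : ∀ x : G, Composable x⁻¹ x
  composable_inv : ∀ x : G, Composable x x⁻¹
  inv_comp_cancel : ∀ (x y : G) (h : Composable x y),
    ∃ k : Composable x⁻¹ (comp x y h), comp x⁻¹ (comp x y h) k = y
  comp_inv_cancel : ∀ (z x : G) (h : Composable z x),
    ∃ k : Composable (comp z x h) x⁻¹, comp (comp z x h) x⁻¹ k = z

section groupoid

variable (G : Type u) [ArrowGroupoid G]

open ArrowGroupoid

variable {G} in
/-- The domain identity `d(x) = x⁻¹x`. -/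
def dom (x : G) : G := comp x⁻¹ x (inv_composable x)

variable {G} in
/-- The range identity `r(x) = xx⁻¹`. -/
def ran (x : G) : G := comp x x⁻¹ (composable_inv x)

/-- The set of identities `G₀`. -/
def identities : Set G := Set.range (ran : G → G)

variable {G} in
theorem dom_mem_identities (x : G) : dom x ∈ identities G := by
  refine ⟨x⁻¹, ?_⟩
  have : ∀ y (hy : y = x) (h : Composable x⁻¹ y), comp x⁻¹ y h = dom x := by
    rintro _ rfl h; rfl
  exact this _ (inv_invol x) _

variable {G} in
/-- Multiplication of subsets. -/
def setMul (A B : Set G) : Set G :=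
  {z | ∃ x ∈ A, ∃ y ∈ B, ∃ h : Composable x y, comp x y h = z}

variable {G} in
/-- The set of inverses of the elements of `A`. -/
def setInv (A : Set G) : Set G := {z | ∃ x ∈ A, x⁻¹ = z}

variable {G} in
/-- A (local) bisection: `A⁻¹A` and `AA⁻¹` consist of identities. -/
def IsBisection (A : Set G) : Prop :=
  setMul (setInv A) A ⊆ identities G ∧ setMul A (setInv A) ⊆ identities G

variable {G} in
def IsCompactOpenBisection [TopologicalSpace G] (A : Set G) : Prop :=
  IsBisection A ∧ IsOpen A ∧ IsCompact A

/-- A topological groupoid: inversion and (partial) multiplication are continuous. -/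
def IsTopologicalGroupoid [TopologicalSpace G] : Prop :=
  Continuous (fun x : G => x⁻¹) ∧
    Continuous (fun p : {p : G × G // Composable p.1 p.2} => comp p.1.1 p.1.2 p.2)

/-- An étale groupoid: a topological groupoid whose domain map `G → G₀` is a local
homeomorphism. -/
def IsEtaleGroupoid [TopologicalSpace G] : Prop :=
  IsTopologicalGroupoid G ∧
    IsLocalHomeomorph (fun x : G => (⟨dom x, dom_mem_identities x⟩ : identities G))

/-- A boolean space: Hausdorff with a basis of compact-open subsets. -/
def IsBooleanSpace (X : Type u) [TopologicalSpace X] : Prop :=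
  T2Space X ∧ TopologicalSpace.IsTopologicalBasis {U : Set X | IsOpen U ∧ IsCompact U}

/-- A boolean groupoid: a Hausdorff étale groupoid with a basis of compact-open bisections whose
space of identities is a boolean space. -/
def IsBooleanGroupoid [TopologicalSpace G] : Prop :=
  T2Space G ∧ IsEtaleGroupoid G ∧
    TopologicalSpace.IsTopologicalBasis {A : Set G | IsCompactOpenBisection A} ∧
    IsBooleanSpace (identities G)

/-- An isomorphism of topological groupoids: a homeomorphism that is an isomorphism of groupoids
(a bijection that preserves and reflects composability and preserves products). -/
structure GroupoidHomeomorph (G : Type u) (H : Type u) [ArrowGroupoid G] [ArrowGroupoid H]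
    [TopologicalSpace G] [TopologicalSpace H] extends G ≃ₜ H where
  composable_iff : ∀ x y : G, Composable x y ↔ Composable (toFun x) (toFun y)
  map_comp : ∀ (x y : G) (h : Composable x y),
    toFun (comp x y h) = comp (toFun x) (toFun y) ((composable_iff x y).1 h)

variable {G}

theorem comp_congr {x x' y y' : G} (hx : x = x') (hy : y = y') (h : Composable x y)
    (h' : Composable x' y') : comp x y h = comp x' y' h' := by
  subst hx hy; rfl

theorem comp_dom (x : G) (h : Composable x (dom x)) : comp x (dom x) h = x := by
  obtain ⟨k, hk⟩ := inv_comp_cancel x⁻¹ x (inv_composable x)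
  exact (comp_congr (inv_invol x).symm rfl h k).trans hk

theorem ran_comp' (x : G) (h : Composable (ran x) x) : comp (ran x) x h = x := by
  obtain ⟨k, hk⟩ := comp_inv_cancel x x⁻¹ (composable_inv x)
  exact (comp_congr rfl (inv_invol x).symm h k).trans hk

theorem composable_iff_dom_eq_ran {x y : G} : Composable x y ↔ dom x = ran y := by
  constructor
  · intro h
    -- both equal the composite of x⁻¹, xy, y⁻¹
    obtain ⟨k, hk⟩ := inv_comp_cancel x y h
    obtain ⟨k', hk'⟩ := comp_inv_cancel x y h
    obtain ⟨a, b, hab⟩ := comp_assoc x⁻¹ (comp x y h) y⁻¹ k k'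
    have e1 : comp (comp x⁻¹ (comp x y h) k) y⁻¹ a = ran y := comp_congr hk rfl _ _
    have e2 : comp x⁻¹ (comp (comp x y h) y⁻¹ k') b = dom x := comp_congr rfl hk' _ _
    rw [← e1, ← e2, hab]
  · intro h
    -- x · d(x) and r(y) · y exist
    obtain ⟨a, b, hab⟩ := comp_assoc x x⁻¹ x (composable_inv x) (inv_composable x)
    obtain ⟨a', b', hab'⟩ := comp_assoc y y⁻¹ y (composable_inv y) (inv_composable y)
    have hx : Composable x (ran y) := by rw [← h]; exact b
    have hy : Composable (ran y) y := a'
    obtain ⟨c, d, hcd⟩ := comp_assoc x (ran y) y hx hy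
    have : comp (ran y) y hy = y := ran_comp' y hy
    have hd := d
    rw [this] at hd
    exact hd

theorem dom_inv (x : G) : dom x⁻¹ = ran x := comp_congr (inv_invol x) rfl _ _

theorem ran_inv (x : G) : ran x⁻¹ = dom x := comp_congr rfl (inv_invol x) _ _

theorem dom_comp (x y : G) (h : Composable x y) : dom (comp x y h) = dom y := by
  obtain ⟨k, _⟩ := comp_inv_cancel x y h
  rw [composable_iff_dom_eq_ran, ran_inv] at k
  exact k

theorem ran_comp (x y : G) (h : Composable x y) : ran (comp x y h) = ran x := by
  obtain ⟨k, _⟩ := inv_comp_cancel x y h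
  rw [composable_iff_dom_eq_ran, dom_inv] at k
  exact k.symm

theorem mem_identities_iff {x : G} : x ∈ identities G ↔ dom x = x := by
  constructor
  · rintro ⟨y, rfl⟩
    have h1 : dom (ran y) = dom y⁻¹ := dom_comp _ _ _
    rw [h1, dom_inv]
  · intro h; rw [← h]; exact dom_mem_identities x

theorem ran_of_mem {x : G} (h : x ∈ identities G) : ran x = x := by
  obtain ⟨y, rfl⟩ := h
  exact ran_comp _ _ _

theorem eq_of_comp_inv_mem {x y : G} (h : Composable x y⁻¹)
    (hm : comp x y⁻¹ h ∈ identities G) : x = y := by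
  obtain ⟨k, hk⟩ := comp_inv_cancel x y⁻¹ h
  have h1 : comp x y⁻¹ h = ran y := by
    rw [← mem_identities_iff.1 hm, dom_comp, dom_inv]
  rw [← hk]
  exact (comp_congr h1 (inv_invol y) k
    (composable_iff_dom_eq_ran.2 ((dom_comp _ _ _).trans (dom_inv y)))).trans (ran_comp' y _)

theorem eq_of_inv_comp_mem {x y : G} (h : Composable x⁻¹ y)
    (hm : comp x⁻¹ y h ∈ identities G) : x = y := by
  obtain ⟨k, hk⟩ := inv_comp_cancel x⁻¹ y h
  have h1 : comp x⁻¹ y h = dom x := by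
    rw [← ran_of_mem hm, ran_comp, ran_inv]
  rw [← hk]
  symm
  exact (comp_congr (inv_invol x) h1 k
    (composable_iff_dom_eq_ran.2 (ran_of_mem (dom_mem_identities x)).symm)).trans (comp_dom x _)

theorem isBisection_iff {A : Set G} : IsBisection A ↔
    (∀ x ∈ A, ∀ y ∈ A, dom x = dom y → x = y) ∧ (∀ x ∈ A, ∀ y ∈ A, ran x = ran y → x = y) := by
  constructor
  · rintro ⟨h1, h2⟩
    refine ⟨fun x hx y hy hxy => ?_, fun x hx y hy hxy => ?_⟩
    · have hc : Composable x y⁻¹ := by rw [composable_iff_dom_eq_ran, ran_inv, hxy]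
      exact eq_of_comp_inv_mem hc (h2 ⟨x, hx, y⁻¹, ⟨y, hy, rfl⟩, hc, rfl⟩)
    · have hc : Composable x⁻¹ y := by rw [composable_iff_dom_eq_ran, dom_inv, hxy]
      exact eq_of_inv_comp_mem hc (h1 ⟨x⁻¹, ⟨x, hx, rfl⟩, y, hy, hc, rfl⟩)
  · rintro ⟨h1, h2⟩
    constructor
    · rintro _ ⟨_, ⟨x, hx, rfl⟩, y, hy, hc, rfl⟩
      have := h2 x hx y hy (by rw [composable_iff_dom_eq_ran, dom_inv] at hc; exact hc)
      subst this
      exact dom_mem_identities x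
    · rintro _ ⟨x, hx, _, ⟨y, hy, rfl⟩, hc, rfl⟩
      have := h1 x hx y hy (by rw [composable_iff_dom_eq_ran, ran_inv] at hc; exact hc)
      subst this
      exact ⟨x, rfl⟩

theorem mem_setInv {A : Set G} {x : G} : x ∈ setInv A ↔ x⁻¹ ∈ A := by
  constructor
  · rintro ⟨y, hy, rfl⟩; rwa [inv_invol]
  · intro h; exact ⟨x⁻¹, h, inv_invol x⟩

theorem inv_comp (x y : G) (h : Composable x y) (h' : Composable y⁻¹ x⁻¹) :
    (comp x y h)⁻¹ = comp y⁻¹ x⁻¹ h' := by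
  -- z = xy; z⁻¹ z y⁻¹ x⁻¹ = z⁻¹
  obtain ⟨k, hk⟩ := comp_inv_cancel x y h
  have c1 : Composable (comp x y h) (comp y⁻¹ x⁻¹ h') := by
    rw [composable_iff_dom_eq_ran, dom_comp, ran_comp, ran_inv]
  obtain ⟨a, b, hab⟩ := comp_assoc (comp x y h) y⁻¹ x⁻¹ k h'
  have hz : comp (comp x y h) (comp y⁻¹ x⁻¹ h') c1 = ran (comp x y h) := by
    rw [ran_comp, ← hab]; exact comp_congr hk rfl _ _
  obtain ⟨l, hl⟩ := inv_comp_cancel (comp x y h) _ c1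
  rw [← hl]
  symm
  have : Composable (comp x y h)⁻¹ (dom (comp x y h)⁻¹) := by
    rw [composable_iff_dom_eq_ran, ran_of_mem (dom_mem_identities _)]
  exact (comp_congr rfl (hz.trans (dom_inv _).symm) _ this).trans (comp_dom _ _)

end groupoid

/-- The property that the compact-open bisections of `G` are closed under inverses and under
subset multiplication. -/
class KBClosed (G : Type u) [ArrowGroupoid G] [TopologicalSpace G] : Prop where
  inv_mem : ∀ A : Set G, IsCompactOpenBisection A → IsCompactOpenBisection (setInv A)
  mul_mem : ∀ A B : Set G, IsCompactOpenBisection A → IsCompactOpenBisection B →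
    IsCompactOpenBisection (setMul A B)

/-- `KB(G)`: the compact-open bisections of `G`. -/
structure KB (G : Type u) [ArrowGroupoid G] [TopologicalSpace G] where
  carrier : Set G
  isCompactOpenBisection : IsCompactOpenBisection carrier

namespace KB

open ArrowGroupoid

variable {G : Type u} [ArrowGroupoid G] [TopologicalSpace G]

@[ext] theorem ext {A B : KB G} (h : A.carrier = B.carrier) : A = B := by
  cases A; cases B; cases h; rfl

theorem dom_inj (A : KB G) {x y : G} (hx : x ∈ A.carrier) (hy : y ∈ A.carrier)
    (h : dom x = dom y) : x = y := (isBisection_iff.1 A.isCompactOpenBisection.1).1 x hx y hy h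

theorem ran_inj (A : KB G) {x y : G} (hx : x ∈ A.carrier) (hy : y ∈ A.carrier)
    (h : ran x = ran y) : x = y := (isBisection_iff.1 A.isCompactOpenBisection.1).2 x hx y hy h

variable [KBClosed G]

instance : Mul (KB G) :=
  ⟨fun A B => ⟨setMul A.carrier B.carrier,
    KBClosed.mul_mem _ _ A.isCompactOpenBisection B.isCompactOpenBisection⟩⟩

instance : Inv (KB G) :=
  ⟨fun A => ⟨setInv A.carrier, KBClosed.inv_mem _ A.isCompactOpenBisection⟩⟩

theorem carrier_mul (A B : KB G) : (A * B).carrier = setMul A.carrier B.carrier := rfl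

theorem carrier_inv (A : KB G) : (A⁻¹).carrier = setInv A.carrier := rfl

instance : Semigroup (KB G) where
  mul_assoc A B C := by
    apply ext
    simp only [carrier_mul]
    ext w
    constructor
    · rintro ⟨_, ⟨x, hx, y, hy, h, rfl⟩, z, hz, h', rfl⟩
      have hyz : Composable y z := by
        rw [composable_iff_dom_eq_ran] at h' ⊢; rw [← h', dom_comp]
      obtain ⟨a, b, hab⟩ := comp_assoc x y z h hyz
      exact ⟨x, hx, _, ⟨y, hy, z, hz, hyz, rfl⟩, b, hab.symm⟩
    · rintro ⟨x, hx, _, ⟨y, hy, z, hz, h, rfl⟩, h', rfl⟩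
      have hxy : Composable x y := by
        rw [composable_iff_dom_eq_ran] at h' ⊢; rw [h', ran_comp]
      obtain ⟨a, b, hab⟩ := comp_assoc x y z hxy h
      exact ⟨_, ⟨x, hx, y, hy, hxy, rfl⟩, z, hz, a, hab⟩

theorem idem_iff {A : KB G} : A * A = A ↔ A.carrier ⊆ identities G := by
  constructor
  · intro h x hx
    have hx' : x ∈ (A * A).carrier := by rw [h]; exact hx
    obtain ⟨y, hy, z, hz, hc, e⟩ := hx'
    have hzx : z = x := A.dom_inj hz hx (by rw [← e, dom_comp])
    have hyx : y = x := A.ran_inj hy hx (by rw [← e, ran_comp])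
    subst hzx
    subst hyx
    obtain ⟨k, hk⟩ := inv_comp_cancel y y hc
    rw [← hk]
    rw [comp_congr rfl e k (inv_composable y)]
    exact dom_mem_identities y
  · intro h
    apply ext
    rw [carrier_mul]
    ext x
    constructor
    · rintro ⟨y, hy, z, hz, hc, rfl⟩
      have h1 : y = z := by
        rw [composable_iff_dom_eq_ran, mem_identities_iff.1 (h hy), ran_of_mem (h hz)] at hc
        exact hc
      subst h1
      have : comp y y hc = y :=
        (comp_congr rfl (mem_identities_iff.1 (h hy)).symm hc
          (by rw [mem_identities_iff.1 (h hy)]; exact hc)).trans (comp_dom y _)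
      rwa [this]
    · intro hx
      have hc : Composable x x := by
        rw [composable_iff_dom_eq_ran, mem_identities_iff.1 (h hx), ran_of_mem (h hx)]
      exact ⟨x, hx, x, hx, hc, (comp_congr rfl (mem_identities_iff.1 (h hx)).symm hc
          (by rw [mem_identities_iff.1 (h hx)]; exact hc)).trans (comp_dom x _)⟩

theorem mul_inv_mul (A : KB G) : A * A⁻¹ * A = A := by
  apply ext
  simp only [carrier_mul, carrier_inv]
  ext w
  constructor
  · rintro ⟨_, ⟨x, hx, _, ⟨y, hy, rfl⟩, h, rfl⟩, z, hz, h', rfl⟩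
    have hxy : x = y := A.dom_inj hx hy (by rw [composable_iff_dom_eq_ran, ran_inv] at h; exact h)
    subst hxy
    have hz' : z = x := A.ran_inj hz hx (by
      rw [composable_iff_dom_eq_ran, dom_comp, dom_inv] at h'; exact h'.symm)
    subst hz'
    have : comp (comp z z⁻¹ h) z h' = z := ran_comp' z h'
    rwa [this]
  · intro hw
    exact ⟨_, ⟨w, hw, w⁻¹, ⟨w, hw, rfl⟩, composable_inv w, rfl⟩, w, hw,
      (comp_assoc w w⁻¹ w (composable_inv w) (inv_composable w)).1, ran_comp' w _⟩

theorem inv_inv_eq (A : KB G) : A⁻¹⁻¹ = A := by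
  apply ext
  ext x
  rw [carrier_inv, mem_setInv, carrier_inv, mem_setInv, inv_invol]

theorem idem_comm (A B : KB G) (hA : A * A = A) (hB : B * B = B) : A * B = B * A := by
  rw [idem_iff] at hA hB
  have key : ∀ A B : KB G, A.carrier ⊆ identities G → B.carrier ⊆ identities G →
      setMul A.carrier B.carrier ⊆ setMul B.carrier A.carrier := by
    rintro A B hA hB _ ⟨x, hx, y, hy, hc, rfl⟩
    have h1 : x = y := by
      rw [composable_iff_dom_eq_ran, mem_identities_iff.1 (hA hx), ran_of_mem (hB hy)] at hc
      exact hc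
    subst h1
    exact ⟨x, hy, x, hx, hc, rfl⟩
  exact ext (Set.Subset.antisymm (key A B hA hB) (key B A hB hA))

instance : InverseSemigroup (KB G) where
  mul_inv_mul := mul_inv_mul
  inv_mul_inv A := by simpa only [inv_inv_eq] using mul_inv_mul A⁻¹
  eq_inv := eq_inv_of_comm mul_inv_mul
    (fun A => by simpa only [inv_inv_eq] using mul_inv_mul A⁻¹) idem_comm

theorem le_iff {A B : KB G} : A ≤ B ↔ A.carrier ⊆ B.carrier := by
  constructor
  · rintro ⟨E, hE, rfl⟩
    have hE' := idem_iff.1 hE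
    rintro _ ⟨x, hx, e, he, hc, rfl⟩
    have h1 : e = dom x := by
      rw [composable_iff_dom_eq_ran, ran_of_mem (hE' he)] at hc; exact hc.symm
    subst h1
    rwa [comp_dom x hc]
  · intro h
    rw [le_iff_right]
    apply ext
    simp only [carrier_mul, carrier_inv]
    ext w
    constructor
    · intro hw
      have hc : Composable w (dom w) := by
        rw [composable_iff_dom_eq_ran, ran_of_mem (dom_mem_identities _)]
      exact ⟨w, h hw, dom w, ⟨w⁻¹, ⟨w, hw, rfl⟩, w, hw, inv_composable w, rfl⟩, hc, comp_dom w hc⟩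
    · rintro ⟨x, hx, _, ⟨_, ⟨y, hy, rfl⟩, z, hz, h', rfl⟩, hc, rfl⟩
      have h1 : y = z := A.ran_inj hy hz (by
        rw [composable_iff_dom_eq_ran, dom_inv] at h'; exact h')
      subst h1
      have h2 : x = y := B.dom_inj hx (h hy) (by
        rw [composable_iff_dom_eq_ran, ran_comp, ran_inv] at hc; exact hc)
      subst h2
      have : comp x (comp x⁻¹ x h') hc = x := comp_dom x hc
      rwa [this]

theorem isCompactOpenBisection_sUnion {𝒜 : Set (KB G)} (hf : 𝒜.Finite) (hc : CompatibleSet 𝒜) :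
    IsCompactOpenBisection (⋃ A ∈ 𝒜, A.carrier) := by
  refine ⟨isBisection_iff.2 ⟨?_, ?_⟩, ?_, ?_⟩
  · intro x hx y hy hxy
    simp only [Set.mem_iUnion] at hx hy
    obtain ⟨A, hA, hx⟩ := hx
    obtain ⟨B, hB, hy⟩ := hy
    have h := idem_iff.1 (hc A hA B hB).2
    have hcomp : Composable x y⁻¹ := by rw [composable_iff_dom_eq_ran, ran_inv, hxy]
    exact eq_of_comp_inv_mem hcomp (h ⟨x, hx, y⁻¹, ⟨y, hy, rfl⟩, hcomp, rfl⟩)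
  · intro x hx y hy hxy
    simp only [Set.mem_iUnion] at hx hy
    obtain ⟨A, hA, hx⟩ := hx
    obtain ⟨B, hB, hy⟩ := hy
    have h := idem_iff.1 (hc A hA B hB).1
    have hcomp : Composable x⁻¹ y := by rw [composable_iff_dom_eq_ran, dom_inv, hxy]
    exact eq_of_inv_comp_mem hcomp (h ⟨x⁻¹, ⟨x, hx, rfl⟩, y, hy, hcomp, rfl⟩)
  · exact isOpen_biUnion fun A _ => A.isCompactOpenBisection.2.1
  · exact hf.isCompact_biUnion fun A _ => A.isCompactOpenBisection.2.2

theorem isLUB_iff {𝒜 : Set (KB G)} (hf : 𝒜.Finite) {J : KB G} :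
    IsLUB 𝒜 J ↔ J.carrier = ⋃ A ∈ 𝒜, A.carrier := by
  constructor
  · intro h
    have hc : CompatibleSet 𝒜 := fun A hA B hB =>
      (compatible_self J).of_le (h.1 hA) (h.1 hB)
    have h1 : J ≤ ⟨_, isCompactOpenBisection_sUnion hf hc⟩ :=
      h.2 fun A hA => le_iff.2 fun x hx => Set.mem_biUnion hA hx
    apply Set.Subset.antisymm (le_iff.1 h1)
    exact Set.iUnion₂_subset fun A hA => le_iff.1 (h.1 hA)
  · intro h
    refine ⟨fun A hA => le_iff.2 ?_, fun B hB => le_iff.2 ?_⟩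
    · rw [h]; exact fun x hx => Set.mem_biUnion hA hx
    · rw [h]; exact Set.iUnion₂_subset fun A hA => le_iff.1 (hB hA)

instance : IsDistributive (KB G) where
  exists_join 𝒜 hf hc := ⟨⟨_, isCompactOpenBisection_sUnion hf hc⟩, (isLUB_iff hf).2 rfl⟩
  mul_join 𝒜 J S hf h := by
    rw [isLUB_iff hf] at h
    rw [isLUB_iff (hf.image _), carrier_mul, h]
    ext w
    simp only [setMul, Set.mem_ofPred_eq, Set.mem_iUnion, Set.mem_image, exists_prop,
      exists_exists_and_eq_and, carrier_mul]
    grind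
  join_mul 𝒜 J S hf h := by
    rw [isLUB_iff hf] at h
    rw [isLUB_iff (hf.image _), carrier_mul, h]
    ext w
    simp only [setMul, Set.mem_ofPred_eq, Set.mem_iUnion, Set.mem_image, exists_prop,
      exists_exists_and_eq_and, carrier_mul]
    grind

end KB

/-- A finite element of a pseudogroup: every covering has a finite subcovering. -/
def IsFiniteElement {T : Type u} [InverseSemigroup T] (a : T) : Prop :=
  ∀ (X : Set T) (j : T), CompatibleSet X → IsLUB X j → a ≤ j →
    ∃ Y : Set T, Y ⊆ X ∧ Y.Finite ∧ ∃ k, IsLUB Y k ∧ a ≤ k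

/-- The pseudogroup `C(S)` of compatible order ideals of `S`. If `S` has a zero then order ideals
are required to contain it, so that `{0}` is the least one; if `S` has no zero then the empty
ideal is the least one. -/
structure CIdeal (S : Type u) [InverseSemigroup S] where
  carrier : Set S
  lower : ∀ a ∈ carrier, ∀ x : S, x ≤ a → x ∈ carrier
  compatible : CompatibleSet carrier
  zero_mem : ∀ z : S, IsBot z → z ∈ carrier

namespace CIdeal

open InverseSemigroup

variable {S : Type u} [InverseSemigroup S]

@[ext] theorem ext {A B : CIdeal S} (h : A.carrier = B.carrier) : A = B := by
  cases A; cases B; cases h; rfl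

theorem isIdem_inv_mul_mul {e : S} (he : IsIdem e) (a b : S) (h : IsIdem (a⁻¹ * b)) :
    IsIdem (a⁻¹ * e * b) :=
  h.of_le (mul_le_mul_both (mul_idem_le _ he) le_rfl)

/-- Subset multiplication. -/
instance : Mul (CIdeal S) :=
  ⟨fun A B =>
    { carrier := {x | ∃ a ∈ A.carrier, ∃ b ∈ B.carrier, a * b = x}
      lower := by
        rintro _ ⟨a, ha, b, hb, rfl⟩ x hx
        refine ⟨a, ha, b * (x⁻¹ * x), B.lower b hb _ (mul_idem_le _ (isIdem_inv_mul x)), ?_⟩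
        rw [← mul_assoc]; exact (le_iff_right.1 hx).symm
      compatible := by
        rintro _ ⟨a, ha, b, hb, rfl⟩ _ ⟨c, hc, d, hd, rfl⟩
        constructor
        · have := isIdem_inv_mul_mul (A.compatible a ha c hc).1 b d (B.compatible b hb d hd).1
          rw [mul_inv_rev']; simpa only [mul_assoc] using this
        · have := isIdem_inv_mul_mul (B.compatible b hb d hd).2 a⁻¹ c⁻¹
            (by rw [inv_inv']; exact (A.compatible a ha c hc).2)
          rw [inv_inv'] at this
          rw [mul_inv_rev']; simpa only [mul_assoc] using this
      zero_mem := fun z hz => ⟨z, A.zero_mem z hz, z, B.zero_mem z hz, isBot_mul_left hz z⟩ }⟩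

theorem isBot_inv {z : S} (hz : IsBot z) : z⁻¹ = z := (isIdem_of_isBot hz).inv_eq

/-- The set of inverses. -/
instance : Inv (CIdeal S) :=
  ⟨fun A =>
    { carrier := {x | x⁻¹ ∈ A.carrier}
      lower := fun a ha x hx => A.lower _ ha _ (inv_le_inv' hx)
      compatible := by
        intro a ha b hb
        have h := A.compatible _ ha _ hb
        rw [Compatible, inv_inv', inv_inv'] at h
        exact ⟨h.2, h.1⟩
      zero_mem := fun z hz => by
        change z⁻¹ ∈ A.carrier
        rw [isBot_inv hz]; exact A.zero_mem z hz }⟩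

theorem mem_mul {A B : CIdeal S} {x : S} :
    x ∈ (A * B).carrier ↔ ∃ a ∈ A.carrier, ∃ b ∈ B.carrier, a * b = x := Iff.rfl

theorem mem_inv {A : CIdeal S} {x : S} : x ∈ (A⁻¹).carrier ↔ x⁻¹ ∈ A.carrier := Iff.rfl

instance : Semigroup (CIdeal S) where
  mul_assoc A B C := by
    apply ext
    ext x
    simp only [mem_mul]
    constructor
    · rintro ⟨_, ⟨a, ha, b, hb, rfl⟩, c, hc, rfl⟩
      exact ⟨a, ha, _, ⟨b, hb, c, hc, rfl⟩, (mul_assoc _ _ _).symm⟩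
    · rintro ⟨a, ha, _, ⟨b, hb, c, hc, rfl⟩, rfl⟩
      exact ⟨_, ⟨a, ha, b, hb, rfl⟩, c, hc, mul_assoc _ _ _⟩

theorem idem_iff {A : CIdeal S} : A * A = A ↔ ∀ a ∈ A.carrier, IsIdem a := by
  constructor
  · intro h a ha
    have ha' : a ∈ (A * A).carrier := by rw [h]; exact ha
    obtain ⟨b, hb, c, hc, rfl⟩ := ha'
    have h1 : IsIdem (b⁻¹ * (b * c)) := (A.compatible b hb _ ha).1
    have h2 : IsIdem (b * c * c⁻¹) := (A.compatible _ ha c hc).2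
    have h3 : b * c = (b * c * c⁻¹) * (b⁻¹ * (b * c)) := by
      calc b * c = (b * b⁻¹ * b) * (c * c⁻¹ * c) := by
            rw [InverseSemigroup.mul_inv_mul, InverseSemigroup.mul_inv_mul]
        _ = b * ((b⁻¹ * b) * (c * c⁻¹)) * c := by simp only [mul_assoc]
        _ = b * ((c * c⁻¹) * (b⁻¹ * b)) * c := by rw [(isIdem_inv_mul b).comm (isIdem_mul_inv c)]
        _ = _ := by simp only [mul_assoc]
    rw [h3]
    exact h2.mul h1
  · intro h
    apply ext
    ext x
    rw [mem_mul]
    constructor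
    · rintro ⟨a, ha, b, hb, rfl⟩
      exact A.lower a ha _ (mul_idem_le a (h b hb))
    · intro hx
      exact ⟨x, hx, x, hx, h x hx⟩

theorem mul_inv_mul (A : CIdeal S) : A * A⁻¹ * A = A := by
  apply ext
  ext x
  constructor
  · rintro ⟨_, ⟨a, ha, b, hb, rfl⟩, c, hc, rfl⟩
    have := (A.compatible a ha _ hb).2
    rw [inv_inv'] at this
    exact A.lower c hc _ (idem_mul_le c this)
  · intro hx
    exact ⟨_, ⟨x, hx, x⁻¹, by rw [mem_inv, inv_inv']; exact hx, rfl⟩, x, hx,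
      InverseSemigroup.mul_inv_mul x⟩

theorem inv_inv_eq (A : CIdeal S) : A⁻¹⁻¹ = A := by
  apply ext
  ext x
  rw [mem_inv, mem_inv, inv_inv']

theorem idem_comm (A B : CIdeal S) (hA : A * A = A) (hB : B * B = B) : A * B = B * A := by
  rw [idem_iff] at hA hB
  apply ext
  ext x
  rw [mem_mul, mem_mul]
  constructor
  · rintro ⟨a, ha, b, hb, rfl⟩
    exact ⟨b, hb, a, ha, ((hA a ha).comm (hB b hb)).symm⟩
  · rintro ⟨b, hb, a, ha, rfl⟩
    exact ⟨a, ha, b, hb, (hA a ha).comm (hB b hb)⟩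

instance : InverseSemigroup (CIdeal S) where
  mul_inv_mul := mul_inv_mul
  inv_mul_inv A := by simpa only [inv_inv_eq] using mul_inv_mul A⁻¹
  eq_inv := eq_inv_of_comm mul_inv_mul
    (fun A => by simpa only [inv_inv_eq] using mul_inv_mul A⁻¹) idem_comm

theorem isIdem_iff {A : CIdeal S} : IsIdem A ↔ ∀ a ∈ A.carrier, IsIdem a := idem_iff

theorem le_iff {A B : CIdeal S} : A ≤ B ↔ A.carrier ⊆ B.carrier := by
  constructor
  · rintro ⟨E, hE, rfl⟩
    rintro _ ⟨b, hb, e, he, rfl⟩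
    exact B.lower b hb _ (mul_idem_le b (isIdem_iff.1 hE e he))
  · intro h
    rw [le_iff_right]
    apply ext
    ext x
    constructor
    · intro hx
      refine ⟨x, h hx, x⁻¹ * x, ⟨x⁻¹, by rw [mem_inv, inv_inv']; exact hx, x, hx, rfl⟩, ?_⟩
      rw [← mul_assoc, InverseSemigroup.mul_inv_mul]
    · rintro ⟨b, hb, _, ⟨c, hc, d, hd, rfl⟩, rfl⟩
      have := (B.compatible b hb _ (h hc)).2
      rw [inv_inv'] at this
      rw [← mul_assoc]
      exact A.lower d hd _ (idem_mul_le d this)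

/-- The principal order ideal generated by `s`. -/
def principal (s : S) : CIdeal S where
  carrier := {x | x ≤ s}
  lower := fun _ ha _ hx => le_trans hx ha
  compatible := fun _ ha _ hb => (compatible_self s).of_le ha hb
  zero_mem := fun _ hz => hz s

theorem compatible_iff {A B : CIdeal S} :
    Compatible A B ↔ ∀ a ∈ A.carrier, ∀ b ∈ B.carrier, Compatible a b := by
  constructor
  · rintro ⟨h1, h2⟩ a ha b hb
    exact ⟨isIdem_iff.1 h1 _ ⟨a⁻¹, by rw [mem_inv, inv_inv']; exact ha, b, hb, rfl⟩,
      isIdem_iff.1 h2 _ ⟨a, ha, b⁻¹, by rw [mem_inv, inv_inv']; exact hb, rfl⟩⟩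
  · intro h
    refine ⟨isIdem_iff.2 ?_, isIdem_iff.2 ?_⟩
    · rintro _ ⟨a, ha, b, hb, rfl⟩
      have := (h _ ha b hb).1
      rwa [inv_inv'] at this
    · rintro _ ⟨a, ha, b, hb, rfl⟩
      have := (h a ha _ hb).2
      rwa [inv_inv'] at this

/-- The union of a compatible family of ideals (together with the zero). -/
def union (X : Set (CIdeal S)) (hX : CompatibleSet X) : CIdeal S where
  carrier := {x | IsBot x ∨ ∃ A ∈ X, x ∈ A.carrier}
  lower := by
    rintro a (ha | ⟨A, hA, ha⟩) x hx
    · left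
      exact fun s => hx.trans (ha s)
    · exact Or.inr ⟨A, hA, A.lower a ha x hx⟩
  compatible := by
    rintro a (ha | ⟨A, hA, ha⟩) b (hb | ⟨B, hB, hb⟩)
    · exact (compatible_self a).of_le le_rfl (hb a)
    · exact (compatible_self b).of_le (ha b) le_rfl
    · exact (compatible_self a).of_le le_rfl (hb a)
    · exact compatible_iff.1 (hX A hA B hB) a ha b hb
  zero_mem := fun z hz => Or.inl hz

theorem isLUB_union (X : Set (CIdeal S)) (hX : CompatibleSet X) : IsLUB X (union X hX) := by
  refine ⟨fun A hA => le_iff.2 fun x hx => Or.inr ⟨A, hA, hx⟩, fun B hB => le_iff.2 ?_⟩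
  rintro x (hx | ⟨A, hA, hx⟩)
  · exact B.zero_mem x hx
  · exact le_iff.1 (hB hA) hx

/-- The finite elements of `C(S)` are the finitely generated compatible order ideals. -/
theorem isFiniteElement_iff {A : CIdeal S} : IsFiniteElement A ↔
    ∃ F : Set S, F.Finite ∧ F ⊆ A.carrier ∧ ∀ x ∈ A.carrier, IsBot x ∨ ∃ f ∈ F, x ≤ f := by
  constructor
  · intro h
    have hX : CompatibleSet (principal '' A.carrier) := by
      rintro _ ⟨a, ha, rfl⟩ _ ⟨b, hb, rfl⟩
      exact compatible_iff.2 fun c hc d hd => (A.compatible a ha b hb).of_le hc hd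
    obtain ⟨Y, hYX, hY, k, hk, hAk⟩ := h _ _ hX (isLUB_union _ hX)
      (le_iff.2 fun x hx => Or.inr ⟨_, ⟨x, hx, rfl⟩, le_refl x⟩)
    obtain ⟨F, hFA, hF, rfl⟩ := (Set.exists_subset_image_finite_and
      (p := fun Z => Z = Y)).1 ⟨Y, hYX, hY, rfl⟩
    refine ⟨F, hF, hFA, fun x hx => ?_⟩
    have hc : CompatibleSet (principal '' F) := fun a ha b hb =>
      hX a (hYX ha) b (hYX hb)
    rw [hk.unique (isLUB_union _ hc)] at hAk
    rcases le_iff.1 hAk hx with hx | ⟨_, ⟨f, hf, rfl⟩, hx⟩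
    · exact Or.inl hx
    · exact Or.inr ⟨f, hf, hx⟩
  · rintro ⟨F, hF, hFA, hA⟩ X j hX hj hAj
    have hj' := hj.unique (isLUB_union X hX)
    subst hj'
    have : ∀ f ∈ F, ∃ Y : Set (CIdeal S), Y ⊆ X ∧ Y.Finite ∧
        (IsBot f ∨ ∃ B ∈ Y, f ∈ B.carrier) := by
      intro f hf
      rcases le_iff.1 hAj (hFA hf) with h | ⟨B, hB, h⟩
      · exact ⟨∅, Set.empty_subset _, Set.finite_empty, Or.inl h⟩
      · exact ⟨{B}, Set.singleton_subset_iff.2 hB, Set.finite_singleton B, Or.inr ⟨B, rfl, h⟩⟩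
    choose! Y hY1 hY2 hY3 using this
    have hsub : (⋃ f ∈ F, Y f) ⊆ X := Set.iUnion₂_subset hY1
    have hc : CompatibleSet (⋃ f ∈ F, Y f) := fun a ha b hb => hX a (hsub ha) b (hsub hb)
    refine ⟨_, hsub, hF.biUnion hY2, _, isLUB_union _ hc, le_iff.2 fun x hx => ?_⟩
    rcases hA x hx with h | ⟨f, hf, hxf⟩
    · exact Or.inl h
    · rcases hY3 f hf with h | ⟨B, hB, h⟩
      · exact Or.inl fun s => hxf.trans (h s)
      · exact Or.inr ⟨B, Set.mem_biUnion hf hB, B.lower f h x hxf⟩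

end CIdeal

/-- The universal distributive inverse semigroup `D(S) = K(C(S))`: the finite elements of the
pseudogroup of compatible order ideals, under subset multiplication. -/
structure DSemigroup (S : Type u) [InverseSemigroup S] where
  val : CIdeal S
  finite : IsFiniteElement val

namespace DSemigroup

open InverseSemigroup

variable {S : Type u} [InverseSemigroup S]

@[ext] theorem ext {A B : DSemigroup S} (h : A.val = B.val) : A = B := by
  cases A; cases B; cases h; rfl

instance : Mul (DSemigroup S) :=
  ⟨fun A B => ⟨A.val * B.val, by
    obtain ⟨F, hF, hFA, hA⟩ := CIdeal.isFiniteElement_iff.1 A.finite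
    obtain ⟨G, hG, hGB, hB⟩ := CIdeal.isFiniteElement_iff.1 B.finite
    refine CIdeal.isFiniteElement_iff.2 ⟨Set.image2 (· * ·) F G, hF.image2 _ hG, ?_, ?_⟩
    · rintro _ ⟨f, hf, g, hg, rfl⟩
      exact ⟨f, hFA hf, g, hGB hg, rfl⟩
    · rintro _ ⟨a, ha, b, hb, rfl⟩
      rcases hA a ha with h | ⟨f, hf, h⟩
      · left; rwa [isBot_mul_right h]
      · rcases hB b hb with h' | ⟨g, hg, h'⟩
        · left; rwa [isBot_mul_left h']
        · exact Or.inr ⟨_, ⟨f, hf, g, hg, rfl⟩, mul_le_mul_both h h'⟩⟩⟩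

instance : Inv (DSemigroup S) :=
  ⟨fun A => ⟨A.val⁻¹, by
    obtain ⟨F, hF, hFA, hA⟩ := CIdeal.isFiniteElement_iff.1 A.finite
    refine CIdeal.isFiniteElement_iff.2 ⟨(·⁻¹) '' F, hF.image _, ?_, ?_⟩
    · rintro _ ⟨f, hf, rfl⟩
      rw [CIdeal.mem_inv, inv_inv']; exact hFA hf
    · intro x hx
      rcases hA _ hx with h | ⟨f, hf, h⟩
      · left
        have := CIdeal.isBot_inv h
        rw [inv_inv'] at this
        rwa [this]
      · exact Or.inr ⟨_, ⟨f, hf, rfl⟩, inv_le_iff.1 h⟩⟩⟩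

theorem val_mul (A B : DSemigroup S) : (A * B).val = A.val * B.val := rfl

theorem val_inv (A : DSemigroup S) : (A⁻¹).val = A.val⁻¹ := rfl

instance : InverseSemigroup (DSemigroup S) where
  mul_assoc A B C := ext (mul_assoc A.val B.val C.val)
  mul_inv_mul A := ext (InverseSemigroup.mul_inv_mul A.val)
  inv_mul_inv A := ext (InverseSemigroup.inv_mul_inv A.val)
  eq_inv A B h h' := ext (InverseSemigroup.eq_inv A.val B.val (congrArg val h) (congrArg val h'))

theorem isIdem_iff {A : DSemigroup S} : IsIdem A ↔ IsIdem A.val :=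
  ⟨fun h => congrArg val h, fun h => ext h⟩

theorem le_iff {A B : DSemigroup S} : A ≤ B ↔ A.val.carrier ⊆ B.val.carrier := by
  rw [← CIdeal.le_iff, le_iff_right, le_iff_right]
  exact ⟨fun h => congrArg val h, fun h => ext h⟩

theorem compatibleSet_image {X : Set (DSemigroup S)} (h : CompatibleSet X) :
    CompatibleSet (val '' X) := by
  rintro _ ⟨A, hA, rfl⟩ _ ⟨B, hB, rfl⟩
  exact ⟨isIdem_iff.1 (h A hA B hB).1, isIdem_iff.1 (h A hA B hB).2⟩

theorem isFiniteElement_union {X : Set (DSemigroup S)} (hX : X.Finite) (h : CompatibleSet X) :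
    IsFiniteElement (CIdeal.union (val '' X) (compatibleSet_image h)) := by
  have := fun A : DSemigroup S => CIdeal.isFiniteElement_iff.1 A.finite
  choose F hF hFA hA using this
  refine CIdeal.isFiniteElement_iff.2 ⟨⋃ A ∈ X, F A, hX.biUnion fun A _ => hF A, ?_, ?_⟩
  · exact Set.iUnion₂_subset fun A hAX f hf => Or.inr ⟨_, ⟨A, hAX, rfl⟩, hFA A hf⟩
  · rintro x (hx | ⟨_, ⟨A, hAX, rfl⟩, hx⟩)
    · exact Or.inl hx
    · rcases hA A x hx with h | ⟨f, hf, h⟩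
      · exact Or.inl h
      · exact Or.inr ⟨f, Set.mem_biUnion hAX hf, h⟩

theorem isLUB_iff {X : Set (DSemigroup S)} (hX : X.Finite) {J : DSemigroup S} :
    IsLUB X J ↔ J.val.carrier = {x | IsBot x ∨ ∃ A ∈ X, x ∈ A.val.carrier} := by
  constructor
  · intro h
    have hc : CompatibleSet X := fun A hA B hB => (compatible_self J).of_le (h.1 hA) (h.1 hB)
    have h1 : J ≤ ⟨_, isFiniteElement_union hX hc⟩ :=
      h.2 fun A hA => le_iff.2 fun x hx => Or.inr ⟨_, ⟨A, hA, rfl⟩, hx⟩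
    ext x
    constructor
    · intro hx
      rcases le_iff.1 h1 hx with h | ⟨_, ⟨A, hA, rfl⟩, h⟩
      · exact Or.inl h
      · exact Or.inr ⟨A, hA, h⟩
    · rintro (hx | ⟨A, hA, hx⟩)
      · exact J.val.zero_mem x hx
      · exact le_iff.1 (h.1 hA) hx
  · intro h
    refine ⟨fun A hA => le_iff.2 fun x hx => ?_, fun B hB => le_iff.2 fun x hx => ?_⟩
    · rw [h]; exact Or.inr ⟨A, hA, hx⟩
    · rw [h] at hx
      rcases hx with hx | ⟨A, hA, hx⟩
      · exact B.val.zero_mem x hx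
      · exact le_iff.1 (hB hA) hx

instance : IsDistributive (DSemigroup S) where
  exists_join X hX hc := by
    refine ⟨⟨_, isFiniteElement_union hX hc⟩, (isLUB_iff hX).2 ?_⟩
    ext x
    simp [CIdeal.union]
  mul_join X J T hX h := by
    rw [isLUB_iff hX] at h
    rw [isLUB_iff (hX.image _)]
    ext x
    rw [val_mul, CIdeal.mem_mul, h]
    constructor
    · rintro ⟨t, ht, j, hj | ⟨A, hA, hj⟩, rfl⟩
      · left; rwa [isBot_mul_left hj]
      · exact Or.inr ⟨_, ⟨A, hA, rfl⟩, ⟨t, ht, j, hj, rfl⟩⟩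
    · rintro (hx | ⟨_, ⟨A, hA, rfl⟩, ⟨t, ht, j, hj, rfl⟩⟩)
      · exact ⟨x, T.val.zero_mem x hx, x, Or.inl hx, isBot_mul_left hx x⟩
      · exact ⟨t, ht, j, Or.inr ⟨A, hA, hj⟩, rfl⟩
  join_mul X J T hX h := by
    rw [isLUB_iff hX] at h
    rw [isLUB_iff (hX.image _)]
    ext x
    rw [val_mul, CIdeal.mem_mul, h]
    constructor
    · rintro ⟨j, hj | ⟨A, hA, hj⟩, t, ht, rfl⟩
      · left; rwa [isBot_mul_right hj]
      · exact Or.inr ⟨_, ⟨A, hA, rfl⟩, ⟨j, hj, t, ht, rfl⟩⟩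
    · rintro (hx | ⟨_, ⟨A, hA, rfl⟩, ⟨j, hj, t, ht, rfl⟩⟩)
      · exact ⟨x, Or.inl hx, x, T.val.zero_mem x hx, isBot_mul_left hx x⟩
      · exact ⟨j, Or.inr ⟨A, hA, hj⟩, t, ht, rfl⟩

end DSemigroup

/-- The proper filters of an inverse semigroup: non-empty, down-directed, upwardly closed subsets
that do not contain the zero. -/
structure ProperFilter (S : Type u) [InverseSemigroup S] where
  carrier : Set S
  nonempty : carrier.Nonempty
  upper : ∀ a ∈ carrier, ∀ x : S, a ≤ x → x ∈ carrier
  directed : ∀ a ∈ carrier, ∀ b ∈ carrier, ∃ c ∈ carrier, c ≤ a ∧ c ≤ b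
  proper : ∀ z ∈ carrier, ¬ IsBot z

namespace ProperFilter

open InverseSemigroup

variable {S : Type u} [InverseSemigroup S]

@[ext] theorem ext {A B : ProperFilter S} (h : A.carrier = B.carrier) : A = B := by
  cases A; cases B; cases h; rfl

/-- `d(A) = (A⁻¹A)↑`. -/
def domSet (A : ProperFilter S) : Set S := {x | ∃ a ∈ A.carrier, ∃ b ∈ A.carrier, a⁻¹ * b ≤ x}

/-- `r(A) = (AA⁻¹)↑`. -/
def ranSet (A : ProperFilter S) : Set S := {x | ∃ a ∈ A.carrier, ∃ b ∈ A.carrier, a * b⁻¹ ≤ x}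

theorem mem_domSet {A : ProperFilter S} {x : S} :
    x ∈ A.domSet ↔ ∃ a ∈ A.carrier, a⁻¹ * a ≤ x := by
  constructor
  · rintro ⟨a, ha, b, hb, h⟩
    obtain ⟨c, hc, hca, hcb⟩ := A.directed a ha b hb
    exact ⟨c, hc, (mul_le_mul_both (inv_le_inv' hca) hcb).trans h⟩
  · rintro ⟨a, ha, h⟩
    exact ⟨a, ha, a, ha, h⟩

theorem mem_ranSet {A : ProperFilter S} {x : S} :
    x ∈ A.ranSet ↔ ∃ a ∈ A.carrier, a * a⁻¹ ≤ x := by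
  constructor
  · rintro ⟨a, ha, b, hb, h⟩
    obtain ⟨c, hc, hca, hcb⟩ := A.directed a ha b hb
    exact ⟨c, hc, (mul_le_mul_both hca (inv_le_inv' hcb)).trans h⟩
  · rintro ⟨a, ha, h⟩
    exact ⟨a, ha, a, ha, h⟩

theorem mul_domSet {A : ProperFilter S} {a h : S} (ha : a ∈ A.carrier) (hh : h ∈ A.domSet) :
    a * h ∈ A.carrier := by
  obtain ⟨b, hb, h1⟩ := mem_domSet.1 hh
  obtain ⟨c, hc, hca, hcb⟩ := A.directed a ha b hb
  refine A.upper c hc _ ?_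
  have := mul_le_mul_both hca ((inv_mul_le hcb).trans h1)
  rwa [← mul_assoc, mul_inv_mul] at this

theorem ranSet_mul {A : ProperFilter S} {a h : S} (ha : a ∈ A.carrier) (hh : h ∈ A.ranSet) :
    h * a ∈ A.carrier := by
  obtain ⟨b, hb, h1⟩ := mem_ranSet.1 hh
  obtain ⟨c, hc, hca, hcb⟩ := A.directed a ha b hb
  refine A.upper c hc _ ?_
  have := mul_le_mul_both ((mul_le_mul_both hcb (inv_le_inv' hcb)).trans h1) hca
  rwa [mul_inv_mul] at this

instance : Inv (ProperFilter S) :=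
  ⟨fun A =>
    { carrier := {x | x⁻¹ ∈ A.carrier}
      nonempty := by
        obtain ⟨a, ha⟩ := A.nonempty
        exact ⟨a⁻¹, by change a⁻¹⁻¹ ∈ A.carrier; rwa [inv_inv']⟩
      upper := fun a ha x hx => A.upper _ ha _ (inv_le_inv' hx)
      directed := by
        intro a ha b hb
        obtain ⟨c, hc, h1, h2⟩ := A.directed _ ha _ hb
        exact ⟨c⁻¹, by change c⁻¹⁻¹ ∈ A.carrier; rwa [inv_inv'], inv_le_iff.2 h1, inv_le_iff.2 h2⟩
      proper := by
        intro z hz hb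
        have : z⁻¹ = z := (isIdem_of_isBot hb).inv_eq
        exact A.proper _ hz (by rwa [this]) }⟩

theorem mem_inv {A : ProperFilter S} {x : S} : x ∈ (A⁻¹).carrier ↔ x⁻¹ ∈ A.carrier := Iff.rfl

theorem inv_mem_inv {A : ProperFilter S} {x : S} : x⁻¹ ∈ (A⁻¹).carrier ↔ x ∈ A.carrier := by
  rw [mem_inv, inv_inv']

theorem inv_mul_mem {A B : ProperFilter S} (h : A.domSet = B.ranSet) {a a' b : S}
    (ha : a ∈ A.carrier) (ha' : a' ∈ A.carrier) (hb : b ∈ B.carrier) :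
    a⁻¹ * (a' * b) ∈ B.carrier := by
  rw [← mul_assoc]
  exact ranSet_mul hb (h ▸ ⟨a, ha, a', ha', le_rfl⟩)

/-- The product `A · B = (AB)↑`, defined when `d(A) = r(B)`. -/
def prod (A B : ProperFilter S) (h : A.domSet = B.ranSet) : ProperFilter S where
  carrier := {x | ∃ a ∈ A.carrier, ∃ b ∈ B.carrier, a * b ≤ x}
  nonempty := by
    obtain ⟨a, ha⟩ := A.nonempty
    obtain ⟨b, hb⟩ := B.nonempty
    exact ⟨a * b, a, ha, b, hb, le_rfl⟩
  upper := fun x ⟨a, ha, b, hb, h⟩ y hy => ⟨a, ha, b, hb, h.trans hy⟩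
  directed := by
    rintro x ⟨a, ha, b, hb, h⟩ y ⟨a', ha', b', hb', h'⟩
    obtain ⟨c, hc, h1, h2⟩ := A.directed a ha a' ha'
    obtain ⟨d, hd, h3, h4⟩ := B.directed b hb b' hb'
    exact ⟨c * d, ⟨c, hc, d, hd, le_rfl⟩, (mul_le_mul_both h1 h3).trans h,
      (mul_le_mul_both h2 h4).trans h'⟩
  proper := by
    rintro z ⟨a, ha, b, hb, hz⟩ hbot
    have h1 : IsBot (a * b) := fun s => hz.trans (hbot s)
    have h2 := inv_mul_mem h ha ha hb
    rw [isBot_mul_left h1] at h2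
    exact B.proper _ h2 h1

theorem mem_prod {A B : ProperFilter S} {h : A.domSet = B.ranSet} {x : S} :
    x ∈ (prod A B h).carrier ↔ ∃ a ∈ A.carrier, ∃ b ∈ B.carrier, a * b ≤ x := Iff.rfl

theorem domSet_inv (A : ProperFilter S) : (A⁻¹).domSet = A.ranSet := by
  ext x
  rw [mem_domSet, mem_ranSet]
  constructor
  · rintro ⟨a, ha, h⟩
    exact ⟨a⁻¹, ha, by rwa [inv_inv']⟩
  · rintro ⟨a, ha, h⟩
    exact ⟨a⁻¹, inv_mem_inv.2 ha, by rwa [inv_inv']⟩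

theorem inv_inv_eq (A : ProperFilter S) : A⁻¹⁻¹ = A := by
  apply ext
  ext x
  rw [mem_inv, inv_mem_inv]

theorem ranSet_inv (A : ProperFilter S) : (A⁻¹).ranSet = A.domSet := by
  rw [← domSet_inv, inv_inv_eq]

theorem domSet_prod (A B : ProperFilter S) (h : A.domSet = B.ranSet) :
    (prod A B h).domSet = B.domSet := by
  ext x
  rw [mem_domSet, mem_domSet]
  constructor
  · rintro ⟨c, ⟨a, ha, b, hb, hab⟩, hc⟩
    refine ⟨_, inv_mul_mem h ha ha hb, le_trans ?_ ((inv_mul_le hab).trans hc)⟩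
    rw [mul_inv_rev', inv_inv']
    calc (a * b)⁻¹ * a * (a⁻¹ * (a * b)) = (a * b)⁻¹ * ((a * a⁻¹) * (a * b)) := by
          simp only [mul_assoc]
      _ ≤ (a * b)⁻¹ * (a * b) := mul_le_mul_both le_rfl (idem_mul_le _ (isIdem_mul_inv a))
  · rintro ⟨b, hb, hx⟩
    have : b * b⁻¹ ∈ A.domSet := by rw [h]; exact mem_ranSet.2 ⟨b, hb, le_rfl⟩
    obtain ⟨a, ha, h1⟩ := mem_domSet.1 this
    refine ⟨a * b, ⟨a, ha, b, hb, le_rfl⟩, le_trans ?_ hx⟩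
    have := mul_le_mul_both (mul_le_mul_both (le_refl b⁻¹) h1) (le_refl b)
    rw [mul_inv_rev']
    calc b⁻¹ * a⁻¹ * (a * b) = b⁻¹ * (a⁻¹ * a) * b := by simp only [mul_assoc]
      _ ≤ b⁻¹ * (b * b⁻¹) * b := this
      _ = b⁻¹ * b := by rw [← mul_assoc, inv_mul_inv]

theorem ranSet_prod (A B : ProperFilter S) (h : A.domSet = B.ranSet) :
    (prod A B h).ranSet = A.ranSet := by
  have h' : (B⁻¹).domSet = (A⁻¹).ranSet := by rw [domSet_inv, ranSet_inv, h]
  have key : (prod A B h)⁻¹ = prod B⁻¹ A⁻¹ h' := by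
    apply ext
    ext x
    rw [mem_inv, mem_prod, mem_prod]
    constructor
    · rintro ⟨a, ha, b, hb, hx⟩
      refine ⟨b⁻¹, inv_mem_inv.2 hb, a⁻¹, inv_mem_inv.2 ha, ?_⟩
      rw [← mul_inv_rev']; exact inv_le_iff.2 hx
    · rintro ⟨b, hb, a, ha, hx⟩
      refine ⟨a⁻¹, ha, b⁻¹, hb, ?_⟩
      rw [← mul_inv_rev']; exact inv_le_inv' hx
  rw [← domSet_inv, key, domSet_prod, domSet_inv]

/-- The groupoid `L(S)` of all proper filters. -/
instance : ArrowGroupoid (ProperFilter S) where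
  Composable A B := A.domSet = B.ranSet
  comp A B h := prod A B h
  inv_invol := inv_inv_eq
  comp_assoc A B C h h' := by
    refine ⟨(domSet_prod A B h).trans h', h.trans (ranSet_prod B C h').symm, ?_⟩
    apply ext
    ext x
    rw [mem_prod, mem_prod]
    constructor
    · rintro ⟨p, ⟨a, ha, b, hb, hab⟩, c, hc, hx⟩
      refine ⟨a, ha, b * c, ⟨b, hb, c, hc, le_rfl⟩, le_trans ?_ hx⟩
      rw [← mul_assoc]; exact mul_le_mul_both hab le_rfl
    · rintro ⟨a, ha, p, ⟨b, hb, c, hc, hbc⟩, hx⟩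
      refine ⟨a * b, ⟨a, ha, b, hb, le_rfl⟩, c, hc, le_trans ?_ hx⟩
      rw [mul_assoc]; exact mul_le_mul_both le_rfl hbc
  inv_composable A := domSet_inv A
  composable_inv A := (ranSet_inv A).symm
  inv_comp_cancel A B h := by
    refine ⟨(domSet_inv A).trans (ranSet_prod A B h).symm, ?_⟩
    apply ext
    ext x
    rw [mem_prod]
    constructor
    · rintro ⟨a, ha, c, ⟨a', ha', b, hb, hc⟩, hx⟩
      have := inv_mul_mem h ha ha' hb
      rw [inv_inv'] at this
      exact B.upper _ this _ ((mul_le_mul_both le_rfl hc).trans hx)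
    · intro hx
      have : x * x⁻¹ ∈ A.domSet := by rw [h]; exact mem_ranSet.2 ⟨x, hx, le_rfl⟩
      obtain ⟨a, ha, h1⟩ := mem_domSet.1 this
      refine ⟨a⁻¹, inv_mem_inv.2 ha, a * x, ⟨a, ha, x, hx, le_rfl⟩, ?_⟩
      rw [← mul_assoc]
      exact idem_mul_le x (isIdem_inv_mul a)
  comp_inv_cancel A B h := by
    refine ⟨(domSet_prod A B h).trans (ranSet_inv B).symm, ?_⟩
    apply ext
    ext x
    rw [mem_prod]
    constructor
    · rintro ⟨c, ⟨a, ha, b, hb, hc⟩, b', hb', hx⟩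
      have h1 : b * b' ∈ A.domSet := by
        rw [h]; exact ⟨b, hb, b'⁻¹, hb', by rw [inv_inv']⟩
      refine A.upper _ (mul_domSet ha h1) _ (le_trans ?_ hx)
      rw [← mul_assoc]; exact mul_le_mul_both hc le_rfl
    · intro hx
      have : x⁻¹ * x ∈ B.ranSet := by rw [← h]; exact mem_domSet.2 ⟨x, hx, le_rfl⟩
      obtain ⟨b, hb, h1⟩ := mem_ranSet.1 this
      refine ⟨x * b, ⟨x, hx, b, hb, le_rfl⟩, b⁻¹, inv_mem_inv.2 hb, ?_⟩
      rw [mul_assoc]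
      exact mul_idem_le x (isIdem_mul_inv b)

end ProperFilter

/-- A prime filter of a distributive inverse semigroup: a proper filter `P` such that
`a ∨ b ∈ P` implies `a ∈ P` or `b ∈ P`. The type of prime filters is `G_P(S)`. -/
structure PrimeFilter (S : Type u) [InverseSemigroup S] where
  toProperFilter : ProperFilter S
  prime : ∀ a b c : S, IsLUB {a, b} c → c ∈ toProperFilter.carrier →
    a ∈ toProperFilter.carrier ∨ b ∈ toProperFilter.carrier

namespace PrimeFilter

open InverseSemigroup

variable {S : Type u} [InverseSemigroup S]

/-- The set of elements of a prime filter. -/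
def carrier (P : PrimeFilter S) : Set S := P.toProperFilter.carrier

@[ext] theorem ext {A B : PrimeFilter S} (h : A.toProperFilter = B.toProperFilter) : A = B := by
  cases A; cases B; cases h; rfl

theorem isLUB_inv {a b c : S} (h : IsLUB {a, b} c) : IsLUB {a⁻¹, b⁻¹} c⁻¹ := by
  simp only [isLUB_iff_le_iff, upperBounds_insert, upperBounds_singleton, Set.mem_inter_iff,
    Set.mem_Ici] at h ⊢
  intro x
  rw [inv_le_iff, inv_le_iff, inv_le_iff, h]

instance : Inv (PrimeFilter S) :=
  ⟨fun P => ⟨P.toProperFilter⁻¹, fun _ _ _ h hc => P.prime _ _ _ (isLUB_inv h) hc⟩⟩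

/-- The product of prime filters, inherited from the groupoid of proper filters. -/
def prod [IsDistributive S] (P Q : PrimeFilter S)
    (h : P.toProperFilter.domSet = Q.toProperFilter.ranSet) : PrimeFilter S where
  toProperFilter := ProperFilter.prod P.toProperFilter Q.toProperFilter h
  prime := by
    rintro x y c hc ⟨a, ha, b, hb, hab⟩
    have h1 : a⁻¹ * c ∈ Q.toProperFilter.carrier :=
      Q.toProperFilter.upper _ (ProperFilter.inv_mul_mem h ha ha hb) _
        (mul_le_mul_both le_rfl hab)
    have h2 := IsDistributive.mul_join {x, y} c a⁻¹ (Set.toFinite _) hc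
    rw [Set.image_pair] at h2
    have h3 : ∀ w, a⁻¹ * w ∈ Q.toProperFilter.carrier →
        w ∈ (ProperFilter.prod P.toProperFilter Q.toProperFilter h).carrier := fun w hw =>
      ⟨a, ha, _, hw, by rw [← mul_assoc]; exact idem_mul_le w (isIdem_mul_inv a)⟩
    exact (Q.prime _ _ _ h2 h1).imp (h3 x) (h3 y)

/-- The groupoid `G_P(S)` of prime filters. -/
instance [IsDistributive S] : ArrowGroupoid (PrimeFilter S) where
  Composable P Q := P.toProperFilter.domSet = Q.toProperFilter.ranSet
  comp P Q h := prod P Q h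
  inv_invol P := ext (ArrowGroupoid.inv_invol P.toProperFilter)
  comp_assoc P Q R h h' := by
    obtain ⟨k, k', e⟩ := ArrowGroupoid.comp_assoc P.toProperFilter Q.toProperFilter
      R.toProperFilter h h'
    exact ⟨k, k', ext e⟩
  inv_composable P := ArrowGroupoid.inv_composable P.toProperFilter
  composable_inv P := ArrowGroupoid.composable_inv P.toProperFilter
  inv_comp_cancel P Q h := by
    obtain ⟨k, e⟩ := ArrowGroupoid.inv_comp_cancel P.toProperFilter Q.toProperFilter h
    exact ⟨k, ext e⟩
  comp_inv_cancel P Q h := by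
    obtain ⟨k, e⟩ := ArrowGroupoid.comp_inv_cancel P.toProperFilter Q.toProperFilter h
    exact ⟨k, ext e⟩

/-- The usual topology on `G_P(S)`, with basis the sets `Y_s` of prime filters containing `s`. -/
instance : TopologicalSpace (PrimeFilter S) :=
  TopologicalSpace.generateFrom {U | ∃ s : S, U = {P : PrimeFilter S | s ∈ P.carrier}}

end PrimeFilter

/-- The weak booleanization of `G_P(S)`, for `S` distributive: the groupoid of prime filters
with the patch topology. -/
def WeakBooleanization (S : Type u) [InverseSemigroup S] : Type u := PrimeFilter S

namespace WeakBooleanization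

variable {S : Type u} [InverseSemigroup S]

instance [IsDistributive S] : ArrowGroupoid (WeakBooleanization S) :=
  inferInstanceAs (ArrowGroupoid (PrimeFilter S))

/-- The patch topology, with basis the sets `Y_{s;t} = Y_s ∩ Y_tᶜ` for `t ≤ s`. -/
instance : TopologicalSpace (WeakBooleanization S) :=
  TopologicalSpace.generateFrom
    {U | ∃ s t : S, t ≤ s ∧ U = {P : PrimeFilter S | s ∈ P.carrier ∧ t ∉ P.carrier}}

end WeakBooleanization

/-- Paterson's universal groupoid `G_u(S)`: the groupoid of all proper filters with the patch
topology. -/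
def UniversalGroupoid (S : Type u) [InverseSemigroup S] : Type u := ProperFilter S

namespace UniversalGroupoid

open ArrowGroupoid InverseSemigroup

variable {S : Type u} [InverseSemigroup S]

instance : ArrowGroupoid (UniversalGroupoid S) := inferInstanceAs (ArrowGroupoid (ProperFilter S))

/-- The set `U_{x;F}` of proper filters that contain `x` and no element of `F`. -/
def basic (x : S) (F : Set S) : Set (UniversalGroupoid S) :=
  {X : ProperFilter S | x ∈ X.carrier ∧ ∀ y ∈ F, y ∉ X.carrier}

/-- The patch topology, with basis the sets `U_{x;x₁,…,xₙ}` for `x₁,…,xₙ ≤ x`. -/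
instance : TopologicalSpace (UniversalGroupoid S) :=
  TopologicalSpace.generateFrom
    {U | ∃ (x : S) (F : Set S), F.Finite ∧ (∀ y ∈ F, y ≤ x) ∧ U = basic x F}

theorem isOpen_basic (x : S) (F : Set S) (hF : F.Finite) (h : ∀ y ∈ F, y ≤ x) :
    IsOpen (basic x F) := TopologicalSpace.isOpen_generateFrom_of_mem ⟨x, F, hF, h, rfl⟩

theorem exists_basic {U : Set (UniversalGroupoid S)} (hU : IsOpen U) {X : ProperFilter S}
    (hX : X ∈ U) : ∃ (x : S) (F : Set S), F.Finite ∧ (∀ y ∈ F, y ≤ x) ∧ X ∈ basic x F ∧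
      basic x F ⊆ U := by
  induction hU with
  | basic U hU =>
    obtain ⟨x, F, hF, h, rfl⟩ := hU
    exact ⟨x, F, hF, h, hX, subset_rfl⟩
  | univ =>
    obtain ⟨x, hx⟩ := X.nonempty
    exact ⟨x, ∅, Set.finite_empty, by simp, ⟨hx, by simp⟩, Set.subset_univ _⟩
  | inter U V _ _ ihU ihV =>
    obtain ⟨x, F, hF, h, hxX, hsub⟩ := ihU hX.1
    obtain ⟨y, H, hH, h', hyX, hsub'⟩ := ihV hX.2
    obtain ⟨z, hz, hzx, hzy⟩ := X.directed x hxX.1 y hyX.1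
    have hi := isIdem_inv_mul z
    refine ⟨z, (fun f => f * (z⁻¹ * z)) '' (F ∪ H), (hF.union hH).image _, ?_, ⟨hz, ?_⟩, ?_⟩
    · rintro _ ⟨f, hf | hf, rfl⟩
      · exact (mul_le_mul_both (h f hf) le_rfl).trans (le_iff_right.1 hzx).ge
      · exact (mul_le_mul_both (h' f hf) le_rfl).trans (le_iff_right.1 hzy).ge
    · rintro _ ⟨f, hf | hf, rfl⟩ hm
      · exact hxX.2 f hf (X.upper _ hm _ (mul_idem_le f hi))
      · exact hyX.2 f hf (X.upper _ hm _ (mul_idem_le f hi))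
    · rintro (Y : ProperFilter S) ⟨hY, hYF⟩
      refine ⟨hsub ⟨Y.upper _ hY _ hzx, fun f hf hfY => ?_⟩,
        hsub' ⟨Y.upper _ hY _ hzy, fun f hf hfY => ?_⟩⟩
      · exact hYF _ ⟨f, Or.inl hf, rfl⟩
          (ProperFilter.mul_domSet hfY (ProperFilter.mem_domSet.2 ⟨z, hY, le_rfl⟩))
      · exact hYF _ ⟨f, Or.inr hf, rfl⟩
          (ProperFilter.mul_domSet hfY (ProperFilter.mem_domSet.2 ⟨z, hY, le_rfl⟩))
  | sUnion 𝒰 _ ih =>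
    obtain ⟨U, hU, hXU⟩ := hX
    obtain ⟨x, F, hF, h, hxX, hsub⟩ := ih U hU hXU
    exact ⟨x, F, hF, h, hxX, hsub.trans (Set.subset_sUnion_of_mem hU)⟩

theorem isOpen_of_basic {U : Set (UniversalGroupoid S)}
    (h : ∀ X ∈ U, ∃ (x : S) (F : Set S), F.Finite ∧ (∀ y ∈ F, y ≤ x) ∧ X ∈ basic x F ∧
      basic x F ⊆ U) : IsOpen U := by
  rw [isOpen_iff_forall_mem_open]
  intro X hX
  obtain ⟨x, F, hF, h1, h2, h3⟩ := h X hX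
  exact ⟨_, h3, isOpen_basic x F hF h1, h2⟩

theorem continuous_inv : Continuous (fun X : UniversalGroupoid S => X⁻¹) := by
  refine continuous_generateFrom_iff.2 ?_
  rintro _ ⟨x, F, hF, h, rfl⟩
  have : (fun X : UniversalGroupoid S => X⁻¹) ⁻¹' basic x F = basic x⁻¹ ((·⁻¹) '' F) := by
    ext X
    constructor
    · rintro ⟨h1, h2⟩
      refine ⟨h1, ?_⟩
      rintro _ ⟨f, hf, rfl⟩ hm
      exact h2 f hf hm
    · rintro ⟨h1, h2⟩
      exact ⟨h1, fun f hf hm => h2 _ ⟨f, hf, rfl⟩ hm⟩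
  rw [this]
  refine isOpen_basic _ _ (hF.image _) ?_
  rintro _ ⟨f, hf, rfl⟩
  exact inv_le_inv' (h f hf)

theorem isClosed_composable :
    IsClosed {p : UniversalGroupoid S × UniversalGroupoid S | Composable p.1 p.2} := by
  rw [← isOpen_compl_iff, isOpen_prod_iff]
  intro (X : ProperFilter S) (Y : ProperFilter S) hXY
  have hne : X.domSet ≠ Y.ranSet := hXY
  by_cases hsub : X.domSet ⊆ Y.ranSet
  · obtain ⟨h, hh, hh'⟩ : ∃ h ∈ Y.ranSet, h ∉ X.domSet := by
      by_contra! hc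
      exact hne (Set.Subset.antisymm hsub hc)
    obtain ⟨y, hy, hyh⟩ := ProperFilter.mem_ranSet.1 hh
    obtain ⟨x, hx⟩ := X.nonempty
    have hi := isIdem_mul_inv y
    refine ⟨basic x {x * (y * y⁻¹)}, basic y ∅,
      isOpen_basic _ _ (Set.finite_singleton _) (by rintro _ rfl; exact mul_idem_le x hi),
      isOpen_basic _ _ Set.finite_empty (by simp), ⟨hx, ?_⟩, ⟨hy, by simp⟩, ?_⟩
    · rintro _ rfl hm
      refine hh' (ProperFilter.mem_domSet.2 ⟨_, hm, le_trans ?_ hyh⟩)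
      rw [mul_inv_rev', hi.inv_eq]
      calc y * y⁻¹ * x⁻¹ * (x * (y * y⁻¹)) = (y * y⁻¹) * ((x⁻¹ * x) * (y * y⁻¹)) := by
            simp only [mul_assoc]
        _ ≤ y * y⁻¹ := mul_idem_le _ ((isIdem_inv_mul x).mul hi)
    · rintro ⟨X', Y'⟩ ⟨⟨hX1, hX2⟩, hY1, -⟩ hc
      have hc' : ProperFilter.domSet X' = ProperFilter.ranSet Y' := hc
      exact hX2 _ rfl (ProperFilter.mul_domSet hX1
        (by rw [hc']; exact ProperFilter.mem_ranSet.2 ⟨y, hY1, le_rfl⟩))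
  · obtain ⟨h, hh, hh'⟩ := Set.not_subset.1 hsub
    obtain ⟨x, hx, hxh⟩ := ProperFilter.mem_domSet.1 hh
    obtain ⟨y, hy⟩ := Y.nonempty
    have hi := isIdem_inv_mul x
    refine ⟨basic x ∅, basic y {(x⁻¹ * x) * y},
      isOpen_basic _ _ Set.finite_empty (by simp),
      isOpen_basic _ _ (Set.finite_singleton _) (by rintro _ rfl; exact idem_mul_le y hi),
      ⟨hx, by simp⟩, ⟨hy, ?_⟩, ?_⟩
    · rintro _ rfl hm
      refine hh' (ProperFilter.mem_ranSet.2 ⟨_, hm, le_trans ?_ hxh⟩)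
      rw [mul_inv_rev', hi.inv_eq]
      calc x⁻¹ * x * y * (y⁻¹ * (x⁻¹ * x)) = (x⁻¹ * x) * ((y * y⁻¹) * (x⁻¹ * x)) := by
            simp only [mul_assoc]
        _ ≤ x⁻¹ * x := mul_idem_le _ ((isIdem_mul_inv y).mul hi)
    · rintro ⟨X', Y'⟩ ⟨⟨hX1, -⟩, hY1, hY2⟩ hc
      have hc' : ProperFilter.domSet X' = ProperFilter.ranSet Y' := hc
      exact hY2 _ rfl (ProperFilter.ranSet_mul hY1
        (by rw [← hc']; exact ProperFilter.mem_domSet.2 ⟨x, hX1, le_rfl⟩))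

theorem continuous_comp : Continuous (fun p : {p : UniversalGroupoid S × UniversalGroupoid S //
    Composable p.1 p.2} => comp p.1.1 p.1.2 p.2) := by
  refine continuous_generateFrom_iff.2 ?_
  rintro _ ⟨s, F, hF, hFs, rfl⟩
  rw [isOpen_iff_forall_mem_open]
  rintro ⟨⟨A, B⟩, hAB⟩ ⟨⟨a, ha, b, hb, hs⟩, hm⟩
  have h1 : IsOpen (basic a ((fun t => t * t⁻¹ * a) '' F)) := by
    refine isOpen_basic _ _ (hF.image _) ?_
    rintro _ ⟨t, ht, rfl⟩
    exact idem_mul_le a (isIdem_mul_inv t)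
  have h2 : IsOpen (basic b (∅ : Set S)) := isOpen_basic _ _ Set.finite_empty (by simp)
  refine ⟨_, ?_, (h1.prod h2).preimage continuous_subtype_val, ⟨ha, ?_⟩, ⟨hb, by simp⟩⟩
  · rintro ⟨⟨A', B'⟩, hAB'⟩ ⟨⟨ha1, ha2⟩, hb1, -⟩
    refine ⟨⟨a, ha1, b, hb1, hs⟩, fun t ht htm => ha2 _ ⟨t, ht, rfl⟩ ?_⟩
    refine ProperFilter.ranSet_mul ha1 ?_
    rw [← ProperFilter.ranSet_prod A' B' hAB']
    exact ProperFilter.mem_ranSet.2 ⟨t, htm, le_rfl⟩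
  · rintro _ ⟨t, ht, rfl⟩ hmem
    refine hm t ht ⟨_, hmem, b, hb, ?_⟩
    rw [mul_assoc]
    exact (mul_le_mul_both le_rfl hs).trans (le_iff_left.1 (hFs t ht)).ge

/-- The filter `(uZ⁻¹Z)↑`, where `su ∈ Z`. -/
def rightFactor (Z : ProperFilter S) (s u : S) (h : s * u ∈ Z.carrier) : ProperFilter S where
  carrier := {x | ∃ z ∈ Z.carrier, u * (z⁻¹ * z) ≤ x}
  nonempty := ⟨_, _, h, le_rfl⟩
  upper := fun x ⟨z, hz, hx⟩ y hy => ⟨z, hz, hx.trans hy⟩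
  directed := by
    rintro x ⟨z, hz, hx⟩ y ⟨z', hz', hy⟩
    obtain ⟨c, hc, h1, h2⟩ := Z.directed z hz z' hz'
    exact ⟨_, ⟨c, hc, le_rfl⟩, (mul_le_mul_both le_rfl (inv_mul_le h1)).trans hx,
      (mul_le_mul_both le_rfl (inv_mul_le h2)).trans hy⟩
  proper := by
    rintro x ⟨z, hz, hx⟩ hbot
    have h1 : IsBot (u * (z⁻¹ * z)) := fun t => hx.trans (hbot t)
    have h2 := ProperFilter.mul_domSet h (ProperFilter.mem_domSet.2 ⟨z, hz, le_rfl⟩)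
    rw [mul_assoc, isBot_mul_left h1] at h2
    exact Z.proper _ h2 h1

theorem domSet_rightFactor (Z : ProperFilter S) (s u : S) (h : s * u ∈ Z.carrier) :
    (rightFactor Z s u h).domSet = Z.domSet := by
  ext x
  rw [ProperFilter.mem_domSet, ProperFilter.mem_domSet]
  constructor
  · rintro ⟨y, ⟨z, hz, hy⟩, hx⟩
    have h2 := ProperFilter.mul_domSet h (ProperFilter.mem_domSet.2 ⟨z, hz, le_rfl⟩)
    refine ⟨_, h2, le_trans ?_ ((inv_mul_le hy).trans hx)⟩
    rw [mul_assoc, mul_inv_rev' s]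
    calc (u * (z⁻¹ * z))⁻¹ * s⁻¹ * (s * (u * (z⁻¹ * z)))
        = (u * (z⁻¹ * z))⁻¹ * ((s⁻¹ * s) * (u * (z⁻¹ * z))) := by simp only [mul_assoc]
      _ ≤ _ := mul_le_mul_both le_rfl (idem_mul_le _ (isIdem_inv_mul s))
  · rintro ⟨z, hz, hx⟩
    refine ⟨_, ⟨z, hz, le_rfl⟩, le_trans ?_ hx⟩
    rw [mul_inv_rev', (isIdem_inv_mul z).inv_eq]
    calc z⁻¹ * z * u⁻¹ * (u * (z⁻¹ * z)) = (z⁻¹ * z) * ((u⁻¹ * u) * (z⁻¹ * z)) := by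
          simp only [mul_assoc]
      _ ≤ z⁻¹ * z := mul_idem_le _ ((isIdem_inv_mul u).mul (isIdem_inv_mul z))

theorem isOpen_setMul {A B : Set (UniversalGroupoid S)} (hA : IsOpen A) (hB : IsOpen B) :
    IsOpen (setMul A B) := by
  refine isOpen_of_basic ?_
  rintro _ ⟨(X : ProperFilter S), hX, (Y : ProperFilter S), hY, hXY, rfl⟩
  obtain ⟨s, F, hF, hFs, hsX, hFA⟩ := exists_basic hA hX
  obtain ⟨u, H, hH, hHu, huY, hHB⟩ := exists_basic hB hY
  have hXY' : X.domSet = Y.ranSet := hXY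
  refine ⟨s * u, ((fun f => f * u) '' F) ∪ ((fun t => s * t) '' H),
    (hF.image _).union (hH.image _), ?_, ⟨⟨s, hsX.1, u, huY.1, le_rfl⟩, ?_⟩, ?_⟩
  · rintro _ (⟨f, hf, rfl⟩ | ⟨t, ht, rfl⟩)
    · exact mul_le_mul_both (hFs f hf) le_rfl
    · exact mul_le_mul_both le_rfl (hHu t ht)
  · rintro _ (⟨f, hf, rfl⟩ | ⟨t, ht, rfl⟩) ⟨a, ha, b, hb, hab⟩
    · have h1 : b * u⁻¹ ∈ X.domSet := by rw [hXY']; exact ⟨b, hb, u, huY.1, le_rfl⟩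
      refine hsX.2 f hf (X.upper _ (ProperFilter.mul_domSet ha h1) _ ?_)
      rw [← mul_assoc]
      refine (mul_le_mul_both hab le_rfl).trans ?_
      rw [mul_assoc]
      exact mul_idem_le f (isIdem_mul_inv u)
    · refine huY.2 t ht (Y.upper _ (ProperFilter.inv_mul_mem hXY' hsX.1 ha hb) _ ?_)
      refine (mul_le_mul_both le_rfl hab).trans ?_
      rw [← mul_assoc]
      exact idem_mul_le t (isIdem_inv_mul s)
  · rintro (Z : ProperFilter S) ⟨hZ1, hZ2⟩
    let Y' : ProperFilter S := rightFactor Z s u hZ1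
    have hY'u : u ∈ Y'.carrier := ⟨_, hZ1, mul_idem_le u (isIdem_inv_mul _)⟩
    have hd : Y'.domSet = Z.domSet := domSet_rightFactor Z s u hZ1
    have hc : Z.domSet = (Y'⁻¹).ranSet := by rw [ProperFilter.ranSet_inv, hd]
    let X' : ProperFilter S := ProperFilter.prod Z Y'⁻¹ hc
    have hX's : s ∈ X'.carrier := ⟨s * u, hZ1, u⁻¹, ProperFilter.inv_mem_inv.2 hY'u, by
      rw [mul_assoc]; exact mul_idem_le s (isIdem_mul_inv u)⟩
    have hX'Y' : X'.domSet = Y'.ranSet := by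
      rw [ProperFilter.domSet_prod, ProperFilter.domSet_inv]
    have hprod : ProperFilter.prod X' Y' hX'Y' = Z := by
      obtain ⟨k, hk⟩ := comp_inv_cancel Z Y'⁻¹ hc
      exact (comp_congr rfl (ProperFilter.inv_inv_eq Y').symm _ k).trans hk
    refine ⟨X', hFA ⟨hX's, fun f hf hm => ?_⟩, Y', hHB ⟨hY'u, fun t ht hm => ?_⟩, hX'Y', hprod⟩
    · refine hZ2 (f * u) (Or.inl ⟨f, hf, rfl⟩) ?_
      rw [← hprod]
      exact ⟨f, hm, u, hY'u, le_rfl⟩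
    · obtain ⟨z, hz, hzt⟩ := hm
      refine hZ2 (s * t) (Or.inr ⟨t, ht, rfl⟩) (Z.upper _ (ProperFilter.mul_domSet hZ1
        (ProperFilter.mem_domSet.2 ⟨z, hz, le_rfl⟩)) _ ?_)
      rw [mul_assoc]
      exact mul_le_mul_both le_rfl hzt

theorem isCompact_setMul {A B : Set (UniversalGroupoid S)} (hA : IsCompact A)
    (hB : IsCompact B) : IsCompact (setMul A B) := by
  have h1 := (isClosed_composable (S := S)).isClosedEmbedding_subtypeVal.isCompact_preimage
    (hA.prod hB)
  have h2 := h1.image (continuous_comp (S := S))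
  convert h2 using 1
  ext Z
  constructor
  · rintro ⟨X, hX, Y, hY, h, rfl⟩
    exact ⟨⟨(X, Y), h⟩, ⟨hX, hY⟩, rfl⟩
  · rintro ⟨⟨⟨X, Y⟩, h⟩, ⟨hX, hY⟩, rfl⟩
    exact ⟨X, hX, Y, hY, h, rfl⟩

instance : KBClosed (UniversalGroupoid S) where
  inv_mem A hA := by
    have hpre : setInv A = (fun X : UniversalGroupoid S => X⁻¹) ⁻¹' A := by
      ext X; exact mem_setInv
    refine ⟨isBisection_iff.2 ⟨?_, ?_⟩, ?_, ?_⟩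
    · rintro _ ⟨X, hX, rfl⟩ _ ⟨Y, hY, rfl⟩ h
      rw [dom_inv, dom_inv] at h
      rw [(isBisection_iff.1 hA.1).2 X hX Y hY h]
    · rintro _ ⟨X, hX, rfl⟩ _ ⟨Y, hY, rfl⟩ h
      rw [ran_inv, ran_inv] at h
      rw [(isBisection_iff.1 hA.1).1 X hX Y hY h]
    · rw [hpre]; exact hA.2.1.preimage continuous_inv
    · exact hA.2.2.image continuous_inv
  mul_mem A B hA hB := by
    refine ⟨isBisection_iff.2 ⟨?_, ?_⟩, isOpen_setMul hA.2.1 hB.2.1,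
      isCompact_setMul hA.2.2 hB.2.2⟩
    · rintro _ ⟨X, hX, Y, hY, h, rfl⟩ _ ⟨X', hX', Y', hY', h', rfl⟩ he
      rw [dom_comp, dom_comp] at he
      have := (isBisection_iff.1 hB.1).1 Y hY Y' hY' he
      subst this
      have := (isBisection_iff.1 hA.1).1 X hX X' hX' (by
        rw [composable_iff_dom_eq_ran] at h h'; rw [h, h'])
      subst this
      rfl
    · rintro _ ⟨X, hX, Y, hY, h, rfl⟩ _ ⟨X', hX', Y', hY', h', rfl⟩ he
      rw [ran_comp, ran_comp] at he
      have := (isBisection_iff.1 hA.1).2 X hX X' hX' he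
      subst this
      have := (isBisection_iff.1 hB.1).2 Y hY Y' hY' (by
        rw [composable_iff_dom_eq_ran] at h h'; rw [← h, h'])
      subst this
      rfl

end UniversalGroupoid

/-- The weakly boolean inverse semigroup `B(S) = KB(G_u(S))` of compact-open bisections of the
universal groupoid. -/
abbrev BSemigroup (S : Type u) [InverseSemigroup S] : Type u := KB (UniversalGroupoid S)

end NCStone

open NCStone

namespace NCStone

universe u

open ArrowGroupoid InverseSemigroup TopologicalSpace

/-! ### Prime filters and arbitrary finite joins. -/

section PrimeFilters

variable {T : Type u} [InverseSemigroup T]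

/-! Every element of `D(S)` is a finite join of principal ideals, so a prime filter `P` of `D(S)` is
determined by those `s` whose principal ideal lies in `P`, and they form a proper filter of `S`.
Conversely, the ideals that meet a proper filter of `S` form a prime filter, because finite joins in
`D(S)` are unions up to the zero. These maps are mutually inverse (`properEquivPrime`) and respect
domains, ranges and products. They are continuous for the patch topologies because omitting finitely
many elements below `x` is the same as omitting the one ideal that they generate. The result is
`universalHomeomorph`.

The statements on `B(S)` come from a duality for any topological groupoid `G` with Hausdorff space
of identities and a basis of compact-open bisections closed under products and inverses. `G` itself
may fail to be Hausdorff, but each bisection is, since `dom` embeds it continuously into the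
identities. Hence differences of nested compact-open bisections are again compact-open bisections
(`isCompactOpenBisection_diff`). This yields relative complements of idempotents and, together with
compactness, shows that every prime filter of `KB G` consists of the bisections through one point
(`pointHomeomorph`). For `G_u(S)` the inputs are compactness of the basic sets (`isCompact_basic`)
and separation of identity filters, which works because idempotents have meets, namely their
products.

The weak meet condition provides finite substitutes for meets of arbitrary elements. It makes
intersections of finitely generated ideals finitely generated, which gives meets in `D(S)`, and it
makes all of `G_u(S)` Hausdorff (`UniversalGroupoid.t2Space`). The remaining properties of a boolean
groupoid then follow from the basis of compact-open bisections and are carried along the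
homeomorphism. -/

theorem PrimeFilter.exists_mem_of_isLUB [IsDistributive T] (P : PrimeFilter T) {X : Set T}
    (hX : X.Finite) {j : T} (hj : IsLUB X j) (hP : j ∈ P.carrier) :
    ∃ x ∈ X, x ∈ P.carrier := by
  induction X, hX using Set.Finite.induction_on generalizing j with
  -- The empty join is the zero, which a proper filter omits.
  | empty => exact absurd (isLUB_empty_iff.1 hj) (P.toProperFilter.proper _ hP)
  | @insert a s _ hs ih =>
    -- Elements with a common upper bound are compatible, so the smaller set also has a join and
    -- binary primeness applies.
    have hc : CompatibleSet s := fun x hx y hy =>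
      (compatible_self j).of_le (hj.1 (Set.mem_insert_of_mem _ hx))
        (hj.1 (Set.mem_insert_of_mem _ hy))
    obtain ⟨k, hk⟩ := IsDistributive.exists_join s hs hc
    have h2 : IsLUB {a, k} j := by
      simp only [isLUB_iff_le_iff, upperBounds_insert, upperBounds_singleton,
        Set.mem_inter_iff, Set.mem_Ici] at hj hk ⊢
      intro b
      rw [hj, hk]
    rcases P.prime _ _ _ h2 hP with h | h
    · exact ⟨a, Set.mem_insert _ _, h⟩
    · obtain ⟨x, hx, hxP⟩ := ih hk h
      exact ⟨x, Set.mem_insert_of_mem _ hx, hxP⟩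

end PrimeFilters

/-! ### Proper filters of `S` as prime filters of `D(S)`. -/

namespace DSemigroup

variable {S : Type u} [InverseSemigroup S]

/-- The principal order ideal of `s`, as an element of `D(S)`. -/
def principal (s : S) : DSemigroup S :=
  ⟨CIdeal.principal s, CIdeal.isFiniteElement_iff.2
    ⟨{s}, Set.finite_singleton s, Set.singleton_subset_iff.2 (le_refl s),
      fun _ hx => Or.inr ⟨s, rfl, hx⟩⟩⟩

theorem principal_le_iff {s : S} {A : DSemigroup S} : principal s ≤ A ↔ s ∈ A.val.carrier :=
  ⟨fun h => le_iff.1 h (le_refl s), fun h => le_iff.2 fun x hx => A.val.lower s h x hx⟩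

/-- The least ideal is the zero ideal if `S` has a zero and the empty ideal otherwise; this form
covers both cases. -/
theorem isBot_iff {Z : DSemigroup S} : IsBot Z ↔ ∀ x ∈ Z.val.carrier, IsBot x := by
  rw [← isLUB_empty_iff, isLUB_iff Set.finite_empty]
  constructor
  · intro h x hx
    rw [h] at hx
    simpa using hx
  · intro h
    ext x
    simp only [Set.mem_empty_iff_false, false_and, exists_false, or_false]
    exact ⟨h x, Z.val.zero_mem x⟩

theorem exists_generators (A : DSemigroup S) : ∃ F : Set S, F.Finite ∧ F ⊆ A.val.carrier ∧
    ∀ x ∈ A.val.carrier, IsBot x ∨ ∃ f ∈ F, x ≤ f := CIdeal.isFiniteElement_iff.1 A.finite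

/-- Finite elements are finitely generated ideals, and joins are unions together with the zero.
Through this decomposition prime filters of `D(S)` are reduced to filters of `S`. -/
theorem exists_isLUB_principal (A : DSemigroup S) :
    ∃ F : Set S, F.Finite ∧ F ⊆ A.val.carrier ∧ IsLUB (principal '' F) A := by
  obtain ⟨F, hF, hFA, hA⟩ := A.exists_generators
  refine ⟨F, hF, hFA, (isLUB_iff (hF.image _)).2 ?_⟩
  ext x
  constructor
  · intro hx
    rcases hA x hx with h | ⟨f, hf, h⟩
    · exact Or.inl h
    · exact Or.inr ⟨_, ⟨f, hf, rfl⟩, h⟩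
  · rintro (h | ⟨_, ⟨f, hf, rfl⟩, h⟩)
    · exact A.val.zero_mem x h
    · exact A.val.lower f (hFA hf) x h

theorem exists_principal_mem {P : PrimeFilter (DSemigroup S)} {A : DSemigroup S}
    (hA : A ∈ P.carrier) : ∃ s ∈ A.val.carrier, principal s ∈ P.carrier := by
  obtain ⟨F, hF, hFA, hlub⟩ := A.exists_isLUB_principal
  obtain ⟨_, ⟨f, hf, rfl⟩, hfP⟩ := P.exists_mem_of_isLUB (hF.image _) hlub hA
  exact ⟨f, hFA hf, hfP⟩

/-- The prime filter of `D(S)` of all ideals that meet the proper filter `A`. -/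
def primeOfProper (A : ProperFilter S) : PrimeFilter (DSemigroup S) where
  toProperFilter :=
    { carrier := {D | ∃ a ∈ A.carrier, a ∈ D.val.carrier}
      nonempty := by
        obtain ⟨a, ha⟩ := A.nonempty
        exact ⟨principal a, a, ha, le_refl a⟩
      upper := fun D ⟨a, ha, hD⟩ E hE => ⟨a, ha, le_iff.1 hE hD⟩
      directed := by
        rintro D ⟨a, ha, hD⟩ E ⟨b, hb, hE⟩
        obtain ⟨c, hc, hca, hcb⟩ := A.directed a ha b hb
        exact ⟨principal c, ⟨c, hc, le_refl c⟩, principal_le_iff.2 (D.val.lower a hD c hca),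
          principal_le_iff.2 (E.val.lower b hE c hcb)⟩
      proper := by
        rintro Z ⟨a, ha, hZ⟩ hbot
        exact A.proper a ha (isBot_iff.1 hbot a hZ) }
  prime := by
    rintro D E J hJ ⟨a, ha, haJ⟩
    rw [(isLUB_iff (Set.toFinite _)).1 hJ] at haJ
    rcases haJ with h | ⟨_, rfl | rfl, h⟩
    · exact absurd h (A.proper a ha)
    · exact Or.inl ⟨a, ha, h⟩
    · exact Or.inr ⟨a, ha, h⟩

theorem principal_mem_primeOfProper {A : ProperFilter S} {s : S} :
    principal s ∈ (primeOfProper A).carrier ↔ s ∈ A.carrier :=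
  ⟨fun ⟨a, ha, h⟩ => A.upper a ha s h, fun h => ⟨s, h, le_refl s⟩⟩

/-- The proper filter of `S` of all elements whose principal ideal lies in `P`. -/
def properOfPrime (P : PrimeFilter (DSemigroup S)) : ProperFilter S where
  carrier := {s | principal s ∈ P.carrier}
  nonempty := by
    obtain ⟨D, hD⟩ := P.toProperFilter.nonempty
    obtain ⟨s, -, hs⟩ := exists_principal_mem hD
    exact ⟨s, hs⟩
  upper := fun a ha x hx => P.toProperFilter.upper _ ha _ (principal_le_iff.2 hx)
  directed := by
    intro a ha b hb
    -- The common lower bound `D` need not be principal, but it contains an element whose principal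
    -- ideal is in the filter.
    obtain ⟨D, hD, hDa, hDb⟩ := P.toProperFilter.directed _ ha _ hb
    obtain ⟨s, hsD, hs⟩ := exists_principal_mem hD
    exact ⟨s, hs, le_iff.1 hDa hsD, le_iff.1 hDb hsD⟩
  proper := fun z hz hb => P.toProperFilter.proper _ hz
    (isBot_iff.2 fun _ hx s => le_trans hx (hb s))

/-- Proper filters of `S` correspond to prime filters of `D(S)`. -/
def properEquivPrime : ProperFilter S ≃ PrimeFilter (DSemigroup S) where
  toFun := primeOfProper
  invFun := properOfPrime
  left_inv A := ProperFilter.ext (Set.ext fun _ => principal_mem_primeOfProper)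
  right_inv P := by
    apply PrimeFilter.ext
    apply ProperFilter.ext
    ext D
    constructor
    · rintro ⟨a, ha, h⟩
      exact P.toProperFilter.upper _ ha _ (principal_le_iff.2 h)
    · intro h
      obtain ⟨s, hsD, hs⟩ := exists_principal_mem h
      exact ⟨s, hs, hsD⟩

/-- The domain of the prime filter depends only on the domain of `A`, by the same rule of meeting a
set; this makes composability transfer. -/
theorem mem_domSet_primeOfProper {A : ProperFilter S} {D : DSemigroup S} :
    D ∈ (primeOfProper A).toProperFilter.domSet ↔ ∃ e ∈ A.domSet, e ∈ D.val.carrier := by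
  constructor
  · rintro ⟨E, ⟨a, ha, hE⟩, E', ⟨b, hb, hE'⟩, h⟩
    exact ⟨a⁻¹ * b, ⟨a, ha, b, hb, le_rfl⟩,
      le_iff.1 h ⟨a⁻¹, by rw [val_inv, CIdeal.mem_inv, inv_inv']; exact hE, b, hE', rfl⟩⟩
  · rintro ⟨e, he, hD⟩
    obtain ⟨a, ha, hae⟩ := ProperFilter.mem_domSet.1 he
    refine ⟨principal a, principal_mem_primeOfProper.2 ha, principal a,
      principal_mem_primeOfProper.2 ha, le_iff.2 ?_⟩
    rintro _ ⟨x, hx, y, hy, rfl⟩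
    exact D.val.lower e hD _ ((mul_le_mul_both (inv_le_iff.1 hx) hy).trans hae)

theorem mem_ranSet_primeOfProper {A : ProperFilter S} {D : DSemigroup S} :
    D ∈ (primeOfProper A).toProperFilter.ranSet ↔ ∃ e ∈ A.ranSet, e ∈ D.val.carrier := by
  constructor
  · rintro ⟨E, ⟨a, ha, hE⟩, E', ⟨b, hb, hE'⟩, h⟩
    exact ⟨a * b⁻¹, ⟨a, ha, b, hb, le_rfl⟩,
      le_iff.1 h ⟨a, hE, b⁻¹, by rw [val_inv, CIdeal.mem_inv, inv_inv']; exact hE', rfl⟩⟩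
  · rintro ⟨e, he, hD⟩
    obtain ⟨a, ha, hae⟩ := ProperFilter.mem_ranSet.1 he
    refine ⟨principal a, principal_mem_primeOfProper.2 ha, principal a,
      principal_mem_primeOfProper.2 ha, le_iff.2 ?_⟩
    rintro _ ⟨x, hx, y, hy, rfl⟩
    exact D.val.lower e hD _ ((mul_le_mul_both hx (inv_le_iff.1 hy)).trans hae)

theorem domSet_eq_ranSet_iff {A B : ProperFilter S} : A.domSet = B.ranSet ↔
    (primeOfProper A).toProperFilter.domSet = (primeOfProper B).toProperFilter.ranSet := by
  constructor
  · intro h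
    ext D
    rw [mem_domSet_primeOfProper, mem_ranSet_primeOfProper, h]
  · intro h
    ext e
    -- Both sets are upward closed, so testing equality on principal ideals recovers their elements.
    have h1 : (∃ x ∈ A.domSet, x ≤ e) ↔ e ∈ A.domSet :=
      ⟨fun ⟨x, ⟨a, ha, b, hb, hx⟩, hxe⟩ => ⟨a, ha, b, hb, hx.trans hxe⟩, fun h => ⟨e, h, le_rfl⟩⟩
    have h2 : (∃ x ∈ B.ranSet, x ≤ e) ↔ e ∈ B.ranSet :=
      ⟨fun ⟨x, ⟨a, ha, b, hb, hx⟩, hxe⟩ => ⟨a, ha, b, hb, hx.trans hxe⟩, fun h => ⟨e, h, le_rfl⟩⟩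
    rw [← h1, ← h2]
    exact mem_domSet_primeOfProper.symm.trans
      ((Set.ext_iff.1 h (principal e)).trans mem_ranSet_primeOfProper)

theorem primeOfProper_prod (A B : ProperFilter S) (h : A.domSet = B.ranSet) :
    primeOfProper (ProperFilter.prod A B h) =
      PrimeFilter.prod (primeOfProper A) (primeOfProper B) (domSet_eq_ranSet_iff.1 h) := by
  apply PrimeFilter.ext
  apply ProperFilter.ext
  ext D
  constructor
  · rintro ⟨x, ⟨a, ha, b, hb, hab⟩, hx⟩
    refine ⟨principal a, principal_mem_primeOfProper.2 ha, principal b,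
      principal_mem_primeOfProper.2 hb, le_iff.2 ?_⟩
    rintro _ ⟨c, hc, d, hd, rfl⟩
    exact D.val.lower x hx _ ((mul_le_mul_both hc hd).trans hab)
  · rintro ⟨E, ⟨a, ha, hE⟩, E', ⟨b, hb, hE'⟩, hD⟩
    exact ⟨a * b, ⟨a, ha, b, hb, le_rfl⟩, le_iff.1 hD ⟨a, hE, b, hE', rfl⟩⟩

theorem continuous_primeOfProper :
    Continuous (X := UniversalGroupoid S) (Y := WeakBooleanization (DSemigroup S)) primeOfProper := by
  refine continuous_generateFrom_iff.2 ?_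
  rintro _ ⟨D, E, hED, rfl⟩
  obtain ⟨F, hF, hFE, hE⟩ := E.exists_generators
  refine UniversalGroupoid.isOpen_of_basic ?_
  rintro (X : ProperFilter S) ⟨⟨g, hg, hgD⟩, hXE⟩
  -- A basic set at `g` may exclude only elements below `g`, whereas a generator `f` of `E` need not
  -- be below `g`. Since `f` and `g` both lie in `D` they are compatible, so `f * (g⁻¹ * g) ≤ g`; a
  -- filter containing `g` contains `f` exactly when it contains this restriction.
  refine ⟨g, (fun f => f * (g⁻¹ * g)) '' F, hF.image _, ?_, ⟨hg, ?_⟩, ?_⟩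
  · rintro _ ⟨f, hf, rfl⟩
    change f * (g⁻¹ * g) ≤ g
    rw [← mul_assoc]
    exact idem_mul_le g (D.val.compatible f (le_iff.1 hED (hFE hf)) g hgD).2
  · rintro _ ⟨f, hf, rfl⟩ hm
    exact hXE ⟨f, X.upper _ hm _ (mul_idem_le f (isIdem_inv_mul g)), hFE hf⟩
  · rintro (Y : ProperFilter S) ⟨hgY, hY⟩
    refine ⟨⟨g, hgY, hgD⟩, ?_⟩
    rintro ⟨a, ha, haE⟩
    rcases hE a haE with h | ⟨f, hf, h⟩
    · exact Y.proper a ha h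
    · exact hY _ ⟨f, hf, rfl⟩ (ProperFilter.mul_domSet (Y.upper a ha f h)
        (ProperFilter.mem_domSet.2 ⟨g, hgY, le_rfl⟩))

theorem continuous_properOfPrime :
    Continuous (X := WeakBooleanization (DSemigroup S)) (Y := UniversalGroupoid S) properOfPrime := by
  refine continuous_generateFrom_iff.2 ?_
  rintro _ ⟨x, F, hF, hFx, rfl⟩
  have hc : CompatibleSet (principal '' F) := by
    rintro _ ⟨f, hf, rfl⟩ _ ⟨g, hg, rfl⟩
    exact (compatible_self (principal x)).of_le (principal_le_iff.2 (hFx f hf))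
      (principal_le_iff.2 (hFx g hg))
  -- The excluded elements all lie below `x`, so their principal ideals have a join `J`. A prime
  -- filter omits `J` exactly when it omits each of them, which turns a finite exclusion into a
  -- single one.
  obtain ⟨J, hJ⟩ := IsDistributive.exists_join _ (hF.image principal) hc
  refine TopologicalSpace.isOpen_generateFrom_of_mem ⟨principal x, J, hJ.2 ?_, ?_⟩
  · rintro _ ⟨f, hf, rfl⟩
    exact principal_le_iff.2 (hFx f hf)
  · ext (P : PrimeFilter (DSemigroup S))
    refine and_congr_right fun _ => ⟨fun h hJP => ?_, fun h f hf hm => h ?_⟩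
    · obtain ⟨_, ⟨f, hf, rfl⟩, hfP⟩ := P.exists_mem_of_isLUB (hF.image _) hJ hJP
      exact h f hf hfP
    · exact P.toProperFilter.upper _ hm _ (hJ.1 ⟨f, hf, rfl⟩)

/-- The universal groupoid of `S` is the weak booleanization of the groupoid of prime filters
of `D(S)`. -/
def universalHomeomorph :
    GroupoidHomeomorph (UniversalGroupoid S) (WeakBooleanization (DSemigroup S)) where
  toEquiv := properEquivPrime
  continuous_toFun := continuous_primeOfProper
  continuous_invFun := continuous_properOfPrime
  composable_iff _ _ := domSet_eq_ranSet_iff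
  map_comp A B h := primeOfProper_prod A B h

/-- The meet is the intersection of ideals. It is finitely generated because it is covered, up to
the zero, by the finitely many intersections of a principal ideal of a generator of `A` with one of
a generator of `B`. -/
theorem isMeetSemigroup (hS : WeakMeetCondition S) : IsMeetSemigroup (DSemigroup S) := by
  intro A B
  obtain ⟨F, hF, hFA, hA⟩ := A.exists_generators
  obtain ⟨G, hG, hGB, hB⟩ := B.exists_generators
  choose H hH hHeq using hS
  have hH' : ∀ f g, ∀ h ∈ H f g, h ≤ f ∧ h ≤ g := fun f g h hh =>
    (hHeq f g).ge ⟨h, hh, le_rfl⟩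
  let M : DSemigroup S :=
    { val :=
        { carrier := A.val.carrier ∩ B.val.carrier
          lower := fun a ha x hx => ⟨A.val.lower a ha.1 x hx, B.val.lower a ha.2 x hx⟩
          compatible := fun a ha b hb => A.val.compatible a ha.1 b hb.1
          zero_mem := fun z hz => ⟨A.val.zero_mem z hz, B.val.zero_mem z hz⟩ }
      finite := by
        refine CIdeal.isFiniteElement_iff.2 ⟨⋃ f ∈ F, ⋃ g ∈ G, H f g,
          hF.biUnion fun f _ => hG.biUnion fun g _ => hH f g, ?_, ?_⟩
        · simp only [Set.iUnion_subset_iff]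
          exact fun f hf g hg h hh => ⟨A.val.lower f (hFA hf) h (hH' f g h hh).1,
            B.val.lower g (hGB hg) h (hH' f g h hh).2⟩
        · rintro x ⟨hxA, hxB⟩
          rcases hA x hxA with h | ⟨f, hf, hxf⟩
          · exact Or.inl h
          rcases hB x hxB with h | ⟨g, hg, hxg⟩
          · exact Or.inl h
          obtain ⟨h, hh, hxh⟩ := (hHeq f g).le ⟨hxf, hxg⟩
          exact Or.inr ⟨h, Set.mem_biUnion hf (Set.mem_biUnion hg hh), hxh⟩ }
  refine ⟨M, ?_, fun D hD => ?_⟩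
  · rintro _ (rfl | rfl)
    · exact le_iff.2 Set.inter_subset_left
    · exact le_iff.2 Set.inter_subset_right
  · exact le_iff.2 (Set.subset_inter (le_iff.1 (hD (Or.inl rfl))) (le_iff.1 (hD (Or.inr rfl))))

end DSemigroup

/-! ### Groupoids with a basis of compact-open bisections, recovered from their bisections. -/

section TopologicalGroupoids

variable {G : Type u} [ArrowGroupoid G] [TopologicalSpace G]

theorem continuous_dom (htop : IsTopologicalGroupoid G) : Continuous (dom : G → G) :=
  htop.2.comp ((htop.1.prodMk continuous_id).subtype_mk inv_composable)

/-- This is continuity of multiplication at a composable pair, phrased in terms of `KB G` so that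
products of filters can be computed. -/
theorem exists_setMul_subset (htop : IsTopologicalGroupoid G)
    (hbasis : IsTopologicalBasis {A : Set G | IsCompactOpenBisection A}) {x y : G}
    (h : Composable x y) {C : Set G} (hC : IsOpen C) (hm : comp x y h ∈ C) :
    ∃ A B : KB G, x ∈ A.carrier ∧ y ∈ B.carrier ∧ setMul A.carrier B.carrier ⊆ C := by
  obtain ⟨W, hW, hWC⟩ := isOpen_induced_iff.1 (hC.preimage htop.2)
  have hxy : (x, y) ∈ W := by
    have h1 : (⟨(x, y), h⟩ : {p : G × G // Composable p.1 p.2}) ∈ Subtype.val ⁻¹' W := by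
      rw [hWC]; exact hm
    exact h1
  obtain ⟨U, V, hU, hV, hxU, hyV, hUV⟩ := isOpen_prod_iff.1 hW x y hxy
  obtain ⟨A, hA, hxA, hAU⟩ := hbasis.exists_subset_of_mem_open hxU hU
  obtain ⟨B, hB, hyB, hBV⟩ := hbasis.exists_subset_of_mem_open hyV hV
  refine ⟨⟨A, hA⟩, ⟨B, hB⟩, hxA, hyB, ?_⟩
  rintro _ ⟨a, ha, b, hb, hab, rfl⟩
  have h1 : (⟨(a, b), hab⟩ : {p : G × G // Composable p.1 p.2}) ∈ Subtype.val ⁻¹' W :=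
    hUV ⟨hAU ha, hBV hb⟩
  rw [hWC] at h1
  exact h1

/-- `dom` maps `A` injectively and continuously into a Hausdorff space, so `A` is Hausdorff even if
`G` is not. The compact set `B` is therefore closed in `A`, and its complement there is open in the
open set `A`. -/
theorem isCompactOpenBisection_diff (htop : IsTopologicalGroupoid G) [T2Space (identities G)]
    {A B : Set G} (hA : IsCompactOpenBisection A) (hB : IsCompactOpenBisection B) (hBA : B ⊆ A) :
    IsCompactOpenBisection (A \ B) := by
  have : T2Space A := by
    refine T2Space.of_injective_continuous
      (f := fun x : A => (⟨dom x.1, dom_mem_identities x.1⟩ : identities G)) ?_ ?_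
    · intro x y h
      exact Subtype.ext ((isBisection_iff.1 hA.1).1 x x.2 y y.2 (congrArg Subtype.val h))
    · exact ((continuous_dom htop).comp continuous_subtype_val).subtype_mk _
  have hB' : IsClosed (Subtype.val ⁻¹' B : Set A) := by
    refine IsCompact.isClosed (Subtype.isCompact_iff.2 ?_)
    rw [Subtype.image_preimage_coe, Set.inter_eq_right.2 hBA]
    exact hB.2.2
  have himage : Subtype.val '' (Subtype.val ⁻¹' B : Set A)ᶜ = A \ B := by
    rw [← Set.preimage_compl, Subtype.image_preimage_coe, Set.sdiff_eq]
  have hopen : IsOpen (A \ B) := by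
    rw [← himage]
    exact hA.2.1.isOpenMap_subtype_val _ hB'.isOpen_compl
  exact ⟨isBisection_iff.2 ⟨fun x hx y hy => (isBisection_iff.1 hA.1).1 x hx.1 y hy.1,
    fun x hx y hy => (isBisection_iff.1 hA.1).2 x hx.1 y hy.1⟩, hopen, hA.2.2.diff hB.2.1⟩

namespace KB

variable [KBClosed G]

theorem isBot_iff {A : KB G} : IsBot A ↔ A.carrier = ∅ := by
  rw [← isLUB_empty_iff, isLUB_iff Set.finite_empty]
  simp

theorem isWeaklyBoolean (htop : IsTopologicalGroupoid G) [T2Space (identities G)] :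
    IsWeaklyBoolean (KB G) := by
  refine ⟨inferInstance, fun E F hE hFE => ?_⟩
  have hE' : E.carrier ⊆ identities G := idem_iff.1 hE
  have hFE' := le_iff.1 hFE
  refine ⟨⟨E.carrier \ F.carrier, isCompactOpenBisection_diff htop E.isCompactOpenBisection
    F.isCompactOpenBisection hFE'⟩, le_iff.2 Set.sdiff_subset,
    (isLUB_iff (Set.toFinite _)).2 ?_, isBot_iff.2 ?_⟩
  · rw [Set.biUnion_pair]
    exact (Set.union_sdiff_cancel hFE').symm
  -- Composable identities are equal, so a point of the product would lie both in `F` and in its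
  -- complement.
  · rw [Set.eq_empty_iff_forall_notMem]
    rintro _ ⟨x, hx, y, hy, h, rfl⟩
    rw [composable_iff_dom_eq_ran, mem_identities_iff.1 (hE' (hFE' hx)),
      ran_of_mem (hE' hy.1)] at h
    exact hy.2 (h ▸ hx)

variable (hbasis : IsTopologicalBasis {A : Set G | IsCompactOpenBisection A})

/-- The prime filter of all compact-open bisections that contain the point `x`. -/
def pointFilter (x : G) : PrimeFilter (KB G) where
  toProperFilter :=
    { carrier := {A | x ∈ A.carrier}
      nonempty := by
        obtain ⟨A, hA, hx, -⟩ := hbasis.exists_subset_of_mem_open (Set.mem_univ x) isOpen_univ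
        exact ⟨⟨A, hA⟩, hx⟩
      upper := fun A hA B hAB => le_iff.1 hAB hA
      directed := by
        intro A hA B hB
        obtain ⟨C, hC, hx, hCAB⟩ := hbasis.exists_subset_of_mem_open (Set.mem_inter hA hB)
          (A.isCompactOpenBisection.2.1.inter B.isCompactOpenBisection.2.1)
        exact ⟨⟨C, hC⟩, hx, le_iff.2 (hCAB.trans Set.inter_subset_left),
          le_iff.2 (hCAB.trans Set.inter_subset_right)⟩
      proper := fun A hA hbot => by
        have h := isBot_iff.1 hbot
        exact Set.notMem_empty x (h ▸ hA) }
  prime := by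
    intro A B C hC hx
    have hC' := (isLUB_iff (Set.toFinite _)).1 hC
    rw [Set.biUnion_pair] at hC'
    exact hC'.le hx

/-- Points with the same filter share a bisection, on which `dom` is injective. It therefore
suffices to separate their domains, and this is where the Hausdorff identities enter. -/
theorem pointFilter_injective (htop : IsTopologicalGroupoid G) [T2Space (identities G)] :
    Function.Injective (pointFilter hbasis) := by
  intro x y h
  have hmem : ∀ A : KB G, x ∈ A.carrier ↔ y ∈ A.carrier := fun A =>
    Set.ext_iff.1 (congrArg PrimeFilter.carrier h) A
  obtain ⟨A, hA, hx, -⟩ := hbasis.exists_subset_of_mem_open (Set.mem_univ x) isOpen_univ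
  have hy := (hmem ⟨A, hA⟩).1 hx
  refine dom_inj ⟨A, hA⟩ hx hy ?_
  by_contra hne
  have hne' : (⟨dom x, dom_mem_identities x⟩ : identities G) ≠ ⟨dom y, dom_mem_identities y⟩ :=
    fun h => hne (congrArg Subtype.val h)
  obtain ⟨U, V, hU, -, hxU, hyV, hUV⟩ := t2_separation hne'
  have hcont : Continuous fun z : G => (⟨dom z, dom_mem_identities z⟩ : identities G) :=
    (continuous_dom htop).subtype_mk _
  obtain ⟨B, hB, hxB, hBU⟩ := hbasis.exists_subset_of_mem_open hxU (hU.preimage hcont)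
  exact Set.disjoint_left.1 hUV (hBU ((hmem ⟨B, hB⟩).1 hxB)) hyV

theorem pointFilter_surjective (htop : IsTopologicalGroupoid G) [T2Space (identities G)] :
    Function.Surjective (pointFilter hbasis) := by
  intro P
  obtain ⟨A, hA⟩ := P.toProperFilter.nonempty
  -- Compactness yields a point `x` of `A` all of whose compact-open neighbourhoods inside `A` that
  -- are bisections belong to `P`. Otherwise finitely many bisections outside `P` would cover `A`,
  -- and `A ∈ P` would be their join, contradicting primeness.
  obtain ⟨x, hxA, hx⟩ : ∃ x ∈ A.carrier, ∀ B : KB G, B ≤ A → x ∈ B.carrier → B ∈ P.carrier := by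
    by_contra! hcon
    have : Nonempty (KB G) := ⟨A⟩
    choose! B hBA hxB hBP using hcon
    obtain ⟨t, htA, ht, htcover⟩ := A.isCompactOpenBisection.2.2.elim_finite_subcover_image
      (b := A.carrier) (c := fun x => (B x).carrier)
      (fun x _ => (B x).isCompactOpenBisection.2.1) (fun x hx => Set.mem_biUnion hx (hxB x hx))
    have hlub : IsLUB (B '' t) A := by
      rw [isLUB_iff (ht.image B), Set.biUnion_image]
      exact Set.Subset.antisymm htcover
        (Set.iUnion₂_subset fun x hx => le_iff.1 (hBA x (htA hx)))
    obtain ⟨_, ⟨x, hx, rfl⟩, hxP⟩ := P.exists_mem_of_isLUB (ht.image B) hlub hA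
    exact hBP x (htA hx) hxP
  refine ⟨x, PrimeFilter.ext (ProperFilter.ext (Set.ext fun B => ⟨fun hB => ?_, fun hB => ?_⟩))⟩
  · obtain ⟨C, hC, hxC, hCB⟩ := hbasis.exists_subset_of_mem_open (Set.mem_inter hB hxA)
      (B.isCompactOpenBisection.2.1.inter A.isCompactOpenBisection.2.1)
    exact P.toProperFilter.upper _
      (hx ⟨C, hC⟩ (le_iff.2 (hCB.trans Set.inter_subset_right)) hxC) _
      (le_iff.2 (hCB.trans Set.inter_subset_left))
  · obtain ⟨C, hC, hCB, hCA⟩ := P.toProperFilter.directed _ hB _ hA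
    refine le_iff.1 hCB ?_
    by_contra hxC
    -- If `x` were outside `C`, then `A \ C` would be a neighbourhood of `x` below `A`, hence in
    -- `P`, although it is disjoint from `C ∈ P`.
    have hdiff := hx ⟨A.carrier \ C.carrier, isCompactOpenBisection_diff htop
      A.isCompactOpenBisection C.isCompactOpenBisection (le_iff.1 hCA)⟩
      (le_iff.2 Set.sdiff_subset) ⟨hxA, hxC⟩
    obtain ⟨D, hD, hDC, hDA⟩ := P.toProperFilter.directed _ hC _ hdiff
    refine P.toProperFilter.proper _ hD (isBot_iff.2 (Set.eq_empty_iff_forall_notMem.2 ?_))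
    exact fun z hz => (le_iff.1 hDA hz).2 (le_iff.1 hDC hz)

/-- Continuity of the product at `(x⁻¹, x)` shows that a bisection around `dom x` contains a product
of bisections around `x⁻¹` and `x`. The domain of a point filter is thus the point filter of the
domain. -/
theorem mem_domSet_pointFilter (htop : IsTopologicalGroupoid G) {x : G} {C : KB G} :
    C ∈ (pointFilter hbasis x).toProperFilter.domSet ↔ dom x ∈ C.carrier := by
  constructor
  · rintro ⟨A, hA, B, hB, h⟩
    exact le_iff.1 h ⟨x⁻¹, ⟨x, hA, rfl⟩, x, hB, inv_composable x, rfl⟩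
  · intro h
    obtain ⟨A, B, hA, hB, hAB⟩ := exists_setMul_subset htop hbasis (inv_composable x)
      C.isCompactOpenBisection.2.1 h
    exact ⟨A⁻¹, mem_setInv.2 hA, B, hB, by rw [inv_inv']; exact le_iff.2 hAB⟩

theorem mem_ranSet_pointFilter (htop : IsTopologicalGroupoid G) {x : G} {C : KB G} :
    C ∈ (pointFilter hbasis x).toProperFilter.ranSet ↔ ran x ∈ C.carrier := by
  constructor
  · rintro ⟨A, hA, B, hB, h⟩
    exact le_iff.1 h ⟨x, hA, x⁻¹, ⟨x, hB, rfl⟩, composable_inv x, rfl⟩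
  · intro h
    obtain ⟨A, B, hA, hB, hAB⟩ := exists_setMul_subset htop hbasis (composable_inv x)
      C.isCompactOpenBisection.2.1 h
    exact ⟨A, hA, B⁻¹, mem_setInv.2 hB, by rw [inv_inv']; exact le_iff.2 hAB⟩

theorem composable_pointFilter_iff (htop : IsTopologicalGroupoid G) [T2Space (identities G)]
    {x y : G} : Composable x y ↔
      Composable (pointFilter hbasis x) (pointFilter hbasis y) := by
  -- By injectivity, `dom x = ran y` can be tested on the bisections containing these identities,
  -- which are the domain and range sets of the two filters.
  rw [composable_iff_dom_eq_ran, ← (pointFilter_injective hbasis htop).eq_iff]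
  constructor
  · intro h
    refine Set.ext fun C => ?_
    rw [mem_domSet_pointFilter hbasis htop, mem_ranSet_pointFilter hbasis htop]
    exact Set.ext_iff.1 (congrArg PrimeFilter.carrier h) C
  · intro h
    refine PrimeFilter.ext (ProperFilter.ext (Set.ext fun C => ?_))
    exact (mem_domSet_pointFilter hbasis htop).symm.trans
      ((Set.ext_iff.1 h C).trans (mem_ranSet_pointFilter hbasis htop))

theorem pointFilter_comp (htop : IsTopologicalGroupoid G) {x y : G} (h : Composable x y)
    (h' : Composable (pointFilter hbasis x) (pointFilter hbasis y)) :
    pointFilter hbasis (comp x y h) = comp (pointFilter hbasis x) (pointFilter hbasis y) h' := by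
  refine PrimeFilter.ext (ProperFilter.ext (Set.ext fun C => ⟨fun hC => ?_, ?_⟩))
  · obtain ⟨A, B, hA, hB, hAB⟩ := exists_setMul_subset htop hbasis h
      C.isCompactOpenBisection.2.1 hC
    exact ⟨A, hA, B, hB, le_iff.2 hAB⟩
  · rintro ⟨A, hA, B, hB, hAB⟩
    exact le_iff.1 hAB ⟨x, hA, y, hB, h, rfl⟩

/-- The generating sets of prime filters pull back to exactly the compact-open bisections, which
generate the topology of `G`. -/
theorem isInducing_pointFilter : Topology.IsInducing (pointFilter hbasis) := by
  refine ⟨?_⟩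
  refine hbasis.eq_generateFrom.trans (Eq.trans ?_ induced_generateFrom_eq.symm)
  congr 1
  ext A
  constructor
  · intro hA
    exact ⟨_, ⟨⟨A, hA⟩, rfl⟩, rfl⟩
  · rintro ⟨_, ⟨B, rfl⟩, rfl⟩
    exact B.isCompactOpenBisection

/-- A groupoid with a basis of compact-open bisections and a Hausdorff space of identities is
the groupoid of prime filters of its compact-open bisections. -/
noncomputable def pointHomeomorph (htop : IsTopologicalGroupoid G) [T2Space (identities G)] :
    GroupoidHomeomorph G (PrimeFilter (KB G)) where
  toHomeomorph := (Equiv.ofBijective (pointFilter hbasis) ⟨pointFilter_injective hbasis htop,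
    pointFilter_surjective hbasis htop⟩).toHomeomorphOfIsInducing (isInducing_pointFilter hbasis)
  composable_iff _ _ := composable_pointFilter_iff hbasis htop
  map_comp _ _ h := pointFilter_comp hbasis htop h _

end KB

end TopologicalGroupoids

/-! ### Compact-open bisections and separation in the universal groupoid. -/

namespace UniversalGroupoid

variable {S : Type u} [InverseSemigroup S]

theorem isTopologicalGroupoid : IsTopologicalGroupoid (UniversalGroupoid S) :=
  ⟨continuous_inv, continuous_comp⟩

/-- A filter is recovered from its domain and any one element `x`: each `c ≤ x` in it equals `x *
(c⁻¹ * c)`. Hence filters sharing an element form a bisection. -/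
theorem eq_of_mem_of_domSet_eq {X Y : ProperFilter S} {x : S} (hX : x ∈ X.carrier)
    (hY : x ∈ Y.carrier) (h : X.domSet = Y.domSet) : X = Y := by
  have key : ∀ {X Y : ProperFilter S}, x ∈ X.carrier → x ∈ Y.carrier → X.domSet = Y.domSet →
      X.carrier ⊆ Y.carrier := by
    intro X Y hX hY h y hy
    obtain ⟨c, hc, hcx, hcy⟩ := X.directed x hX y hy
    have h1 : c⁻¹ * c ∈ Y.domSet := h ▸ ProperFilter.mem_domSet.2 ⟨c, hc, le_rfl⟩
    exact Y.upper _ (ProperFilter.mul_domSet hY h1) _ ((le_iff_right.1 hcx).ge.trans hcy)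
  exact ProperFilter.ext (Set.Subset.antisymm (key hX hY h) (key hY hX h.symm))

theorem dom_eq_iff {X Y : UniversalGroupoid S} :
    dom X = dom Y ↔ ProperFilter.domSet X = ProperFilter.domSet Y := by
  constructor
  · intro h
    rw [← ProperFilter.domSet_prod _ X (ProperFilter.domSet_inv X),
      ← ProperFilter.domSet_prod _ Y (ProperFilter.domSet_inv Y)]
    exact congrArg ProperFilter.domSet h
  · intro h
    have h1 : Composable X Y⁻¹ := h.trans (ProperFilter.ranSet_inv Y).symm
    rw [composable_iff_dom_eq_ran, ran_inv] at h1
    exact h1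

theorem isBisection_basic (x : S) (F : Set S) : IsBisection (basic x F) := by
  have key : ∀ X Y : UniversalGroupoid S, ∀ z : S, z ∈ X.carrier → z ∈ Y.carrier →
      dom X = dom Y → X = Y := fun X Y z hX hY h =>
    eq_of_mem_of_domSet_eq hX hY (dom_eq_iff.1 h)
  refine isBisection_iff.2 ⟨fun X hX Y hY h => key X Y x hX.1 hY.1 h, fun X hX Y hY h => ?_⟩
  -- Inversion exchanges ranges with domains, which reduces the range half to the domain half.
  have h1 := key X⁻¹ Y⁻¹ x⁻¹ (ProperFilter.inv_mem_inv.2 hX.1) (ProperFilter.inv_mem_inv.2 hY.1)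
    (by rw [dom_inv, dom_inv, h])
  rw [← inv_invol X, h1, inv_invol]

/-- The limit of an ultrafilter of proper filters that converges inside `U_x`. -/
def ultrafilterLimit (𝒰 : Ultrafilter (UniversalGroupoid S)) (x : S) (hx : basic x ∅ ∈ 𝒰) :
    ProperFilter S where
  -- The witness `z` is kept below `x` because two elements `z`, `z'` below `x` have the explicit
  -- lower bound `z * (z'⁻¹ * z')`, contained in every filter that contains both. For elements
  -- without a common upper bound, the lower bound could vary from filter to filter.
  carrier := {y | ∃ z, z ≤ x ∧ z ≤ y ∧ basic z ∅ ∈ 𝒰}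
  nonempty := ⟨x, x, le_rfl, le_rfl, hx⟩
  upper := fun y ⟨z, hzx, hzy, hz⟩ w hw => ⟨z, hzx, hzy.trans hw, hz⟩
  directed := by
    rintro y ⟨z, hzx, hzy, hz⟩ y' ⟨z', hzx', hzy', hz'⟩
    have h1 : z * (z'⁻¹ * z') ≤ z := mul_idem_le z (isIdem_inv_mul z')
    have h2 : z * (z'⁻¹ * z') ≤ z' :=
      (mul_le_mul_both hzx le_rfl).trans (le_iff_right.1 hzx').ge
    refine ⟨_, ⟨_, h1.trans hzx, le_rfl, ?_⟩, h1.trans hzy, h2.trans hzy'⟩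
    filter_upwards [hz, hz'] with X hX hX'
    exact ⟨ProperFilter.mul_domSet hX.1 (ProperFilter.mem_domSet.2 ⟨z', hX'.1, le_rfl⟩),
      by simp⟩
  proper := by
    rintro y ⟨z, -, hzy, hz⟩ hbot
    obtain ⟨X, hX⟩ := 𝒰.nonempty_of_mem hz
    exact ProperFilter.proper X z hX.1 fun s => hzy.trans (hbot s)

/-- An ultrafilter containing the basic set converges to `ultrafilterLimit`. Elements of the limit
belong to `𝒰`-almost every filter, and an element excluded near the limit is omitted by `𝒰`-almost
every filter. -/
theorem isCompact_basic (x : S) (F : Set S) : IsCompact (basic x F) := by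
  rw [isCompact_iff_ultrafilter_le_nhds']
  intro 𝒰 h𝒰
  have hx : basic x ∅ ∈ 𝒰 := Filter.mem_of_superset h𝒰 fun X hX => ⟨hX.1, by simp⟩
  refine ⟨ultrafilterLimit 𝒰 x hx, ⟨⟨x, le_rfl, le_rfl, hx⟩, ?_⟩, ?_⟩
  · rintro f hf ⟨z, -, hzf, hz⟩
    obtain ⟨X, hX, hX'⟩ := 𝒰.nonempty_of_mem (Filter.inter_mem hz h𝒰)
    exact hX'.2 f hf (ProperFilter.upper X z hX.1 f hzf)
  · intro U hU
    obtain ⟨V, hVU, hV, hmV⟩ := mem_nhds_iff.1 hU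
    obtain ⟨y, H, hH, hHy, ⟨⟨z, hzx, hzy, hz⟩, hyH⟩, hsub⟩ := exists_basic hV hmV
    have hH' : ∀ f ∈ H, (basic f ∅)ᶜ ∈ 𝒰 := by
      intro f hf
      -- If `𝒰`-almost every filter contained `f`, the restriction `f * (z⁻¹ * z)`, which lies below
      -- `z ≤ x`, would witness that `f` is in the limit.
      rw [Ultrafilter.compl_mem_iff_notMem]
      intro hfm
      have h1 : f * (z⁻¹ * z) ≤ z :=
        (mul_le_mul_both (hHy f hf) le_rfl).trans (le_iff_right.1 hzy).ge
      refine hyH f hf ⟨f * (z⁻¹ * z), h1.trans hzx, mul_idem_le f (isIdem_inv_mul z), ?_⟩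
      filter_upwards [hz, hfm] with X hX hX'
      exact ⟨ProperFilter.mul_domSet hX'.1 (ProperFilter.mem_domSet.2 ⟨z, hX.1, le_rfl⟩),
        by simp⟩
    filter_upwards [hz, (Filter.biInter_mem hH).2 hH'] with X hX hXH
    refine hVU (hsub ⟨ProperFilter.upper X z hX.1 y hzy, fun f hf hfX => ?_⟩)
    exact Set.mem_iInter₂.1 hXH f hf ⟨hfX, by simp⟩

theorem isCompactOpenBisection_basic (x : S) {F : Set S} (hF : F.Finite) (hFx : ∀ f ∈ F, f ≤ x) :
    IsCompactOpenBisection (basic x F) :=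
  ⟨isBisection_basic x F, isOpen_basic x F hF hFx, isCompact_basic x F⟩

theorem isTopologicalBasis :
    IsTopologicalBasis {A : Set (UniversalGroupoid S) | IsCompactOpenBisection A} := by
  refine isTopologicalBasis_of_isOpen_of_nhds (fun A hA => hA.2.1) fun X U hX hU => ?_
  obtain ⟨x, F, hF, hFx, hXF, hsub⟩ := exists_basic hU hX
  exact ⟨_, isCompactOpenBisection_basic x hF hFx, hXF, hsub⟩

/-- For identities this shows that the filter is generated by the idempotents `a⁻¹ * a`, the fact
used to separate them. -/
theorem domSet_eq_carrier {X : UniversalGroupoid S} (hX : X ∈ identities (UniversalGroupoid S)) :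
    ProperFilter.domSet X = X.carrier := by
  have h := congrArg ProperFilter.carrier (mem_identities_iff.1 hX)
  rw [← h]
  ext x
  constructor
  · rintro ⟨a, ha, b, hb, hx⟩
    exact ⟨a⁻¹, ProperFilter.inv_mem_inv.2 ha, b, hb, hx⟩
  · rintro ⟨a, ha, b, hb, hx⟩
    exact ⟨a⁻¹, ha, b, hb, by rwa [inv_inv']⟩

theorem exists_mem_notMem_of_ne {X Y : ProperFilter S} (hXY : X ≠ Y) :
    (∃ x ∈ X.carrier, x ∉ Y.carrier) ∨ ∃ y ∈ Y.carrier, y ∉ X.carrier := by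
  by_contra! h
  exact hXY (ProperFilter.ext (Set.Subset.antisymm h.1 h.2))

instance : T2Space (identities (UniversalGroupoid S)) := by
  have key : ∀ X Y : identities (UniversalGroupoid S), ∀ x ∈ X.1.carrier, x ∉ Y.1.carrier →
      ∃ U V : Set (identities (UniversalGroupoid S)), IsOpen U ∧ IsOpen V ∧ X ∈ U ∧ Y ∈ V ∧
        Disjoint U V := by
    rintro ⟨X, hX⟩ ⟨Y, hY⟩ x hxX hxY
    rw [← domSet_eq_carrier hX] at hxX
    obtain ⟨a, ha, hax⟩ := ProperFilter.mem_domSet.1 hxX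
    have he : a⁻¹ * a ∈ X.carrier := by
      rw [← domSet_eq_carrier hX]
      exact ProperFilter.mem_domSet.2 ⟨a, ha, le_rfl⟩
    obtain ⟨b, hb⟩ := ProperFilter.nonempty Y
    have hf : b⁻¹ * b ∈ Y.carrier := by
      rw [← domSet_eq_carrier hY]
      exact ProperFilter.mem_domSet.2 ⟨b, hb, le_rfl⟩
    have hi := isIdem_inv_mul a
    -- With idempotents `e = a⁻¹ * a ≤ x` in `X` and `f = b⁻¹ * b` in `Y`, the product `f * e` is
    -- not in `Y`, since it lies below `x`. An identity filter containing both `e` and `f` contains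
    -- `f * e`, so the two open sets are disjoint.
    refine ⟨Subtype.val ⁻¹' basic (a⁻¹ * a) ∅, Subtype.val ⁻¹' basic (b⁻¹ * b) {b⁻¹ * b * (a⁻¹ * a)},
      (isOpen_basic _ _ Set.finite_empty (by simp)).preimage continuous_subtype_val,
      (isOpen_basic _ _ (Set.finite_singleton _) ?_).preimage continuous_subtype_val,
      ⟨he, by simp⟩, ⟨hf, ?_⟩, ?_⟩
    · rintro _ rfl
      exact mul_idem_le _ hi
    · rintro _ rfl hm
      exact hxY (ProperFilter.upper Y _ hm _ ((idem_mul_le _ (isIdem_inv_mul b)).trans hax))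
    · rw [Set.disjoint_left]
      rintro ⟨Z, hZ⟩ ⟨h1, -⟩ ⟨h2, h3⟩
      refine h3 _ rfl (ProperFilter.mul_domSet h2 ?_)
      rw [domSet_eq_carrier hZ]
      exact h1
  refine ⟨fun X Y hXY => ?_⟩
  rcases exists_mem_notMem_of_ne (fun h => hXY (Subtype.ext h)) with ⟨x, hx, hx'⟩ | ⟨y, hy, hy'⟩
  · exact key X Y x hx hx'
  · obtain ⟨U, V, hU, hV, h1, h2, h3⟩ := key Y X y hy hy'
    exact ⟨V, U, hV, hU, h2, h1, h3.symm⟩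

/-- The finite set `F` generating the common lower bounds of `x` and `y` replaces a meet: a filter
containing both must contain some member of `F`, while `Y` omits all of them because it omits `x`.
-/
theorem t2Space (hS : WeakMeetCondition S) : T2Space (UniversalGroupoid S) := by
  have key : ∀ X Y : UniversalGroupoid S, ∀ x ∈ X.carrier, x ∉ Y.carrier →
      ∃ U V : Set (UniversalGroupoid S), IsOpen U ∧ IsOpen V ∧ X ∈ U ∧ Y ∈ V ∧
        Disjoint U V := by
    intro X Y x hx hxY
    obtain ⟨y, hy⟩ := ProperFilter.nonempty Y
    obtain ⟨F, hF, hFeq⟩ := hS x y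
    have hF' : ∀ f ∈ F, f ≤ x ∧ f ≤ y := fun f hf => hFeq.ge ⟨f, hf, le_rfl⟩
    refine ⟨basic x ∅, basic y F, isOpen_basic _ _ Set.finite_empty (by simp),
      isOpen_basic _ _ hF fun f hf => (hF' f hf).2, ⟨hx, by simp⟩, ⟨hy, fun f hf hfY => ?_⟩, ?_⟩
    · exact hxY (ProperFilter.upper Y f hfY x (hF' f hf).1)
    · rw [Set.disjoint_left]
      rintro (Z : ProperFilter S) ⟨h1, -⟩ ⟨h2, h3⟩
      obtain ⟨c, hc, hcx, hcy⟩ := Z.directed x h1 y h2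
      obtain ⟨f, hf, hcf⟩ := hFeq.le ⟨hcx, hcy⟩
      exact h3 f hf (Z.upper c hc f hcf)
  refine ⟨fun X Y hXY => ?_⟩
  rcases exists_mem_notMem_of_ne hXY with ⟨x, hx, hx'⟩ | ⟨y, hy, hy'⟩
  · exact key X Y x hx hx'
  · obtain ⟨U, V, hU, hV, h1, h2, h3⟩ := key Y X y hy hy'
    exact ⟨V, U, hV, hU, h2, h1, h3.symm⟩

end UniversalGroupoid

/-! ### Étale and boolean groupoids from a basis of compact-open bisections. -/

section BooleanGroupoids

/-- Identifies the image of a bisection under `dom` with `A⁻¹A`, so that closure of `KB G` under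
products makes domain images open. -/
theorem mem_setMul_setInv_self {G : Type u} [ArrowGroupoid G] {A : Set G} (hA : IsBisection A)
    {y : G} : y ∈ setMul (setInv A) A ↔ ∃ x ∈ A, dom x = y := by
  constructor
  · rintro ⟨_, ⟨x, hx, rfl⟩, z, hz, h, rfl⟩
    have hxz : x = z := (isBisection_iff.1 hA).2 x hx z hz (by
      rw [composable_iff_dom_eq_ran, dom_inv] at h; exact h)
    subst hxz
    exact ⟨x, hx, rfl⟩
  · rintro ⟨x, hx, rfl⟩
    exact ⟨x⁻¹, ⟨x, hx, rfl⟩, x, hx, inv_composable x, rfl⟩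

variable {G : Type u} [ArrowGroupoid G] [TopologicalSpace G]

/-- An identity `x` in a bisection `A` equals its own domain, so it lies in `A⁻¹A`, an open set of
identities. -/
theorem isOpen_identities [KBClosed G]
    (hbasis : IsTopologicalBasis {A : Set G | IsCompactOpenBisection A}) :
    IsOpen (identities G) := by
  rw [isOpen_iff_forall_mem_open]
  intro x hx
  obtain ⟨A, hA, hxA, -⟩ := hbasis.exists_subset_of_mem_open (Set.mem_univ x) isOpen_univ
  exact ⟨_, hA.1.1, (KBClosed.mul_mem _ _ (KBClosed.inv_mem _ hA) hA).2.1,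
    (mem_setMul_setInv_self hA.1).2 ⟨x, hxA, mem_identities_iff.1 hx⟩⟩

/-- `dom` is open because it sends a basic bisection `A` to the open set `A⁻¹A`, and it is injective
on `A`; hence it restricts to an open embedding near every point. -/
theorem isEtaleGroupoid [KBClosed G] (htop : IsTopologicalGroupoid G)
    (hbasis : IsTopologicalBasis {A : Set G | IsCompactOpenBisection A}) : IsEtaleGroupoid G := by
  refine ⟨htop, isLocalHomeomorph_iff_isOpenEmbedding_restrict.2 fun x => ?_⟩
  have hcont : Continuous fun z : G => (⟨dom z, dom_mem_identities z⟩ : identities G) :=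
    (continuous_dom htop).subtype_mk _
  have hopen : IsOpenMap fun z : G => (⟨dom z, dom_mem_identities z⟩ : identities G) := by
    refine hbasis.isOpenMap_iff.2 fun A hA => ?_
    convert (KBClosed.mul_mem _ _ (KBClosed.inv_mem _ hA) hA).2.1.preimage
      (continuous_subtype_val (p := (· ∈ identities G))) using 1
    ext y
    rw [Set.mem_preimage, mem_setMul_setInv_self hA.1]
    simp [Subtype.ext_iff]
  obtain ⟨A, hA, hxA, -⟩ := hbasis.exists_subset_of_mem_open (Set.mem_univ x) isOpen_univ
  refine ⟨A, hA.2.1.mem_nhds hxA, .of_continuous_injective_isOpenMap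
    (hcont.comp continuous_subtype_val) ?_ (hopen.domRestrict hA.2.1)⟩
  intro y z h
  exact Subtype.ext ((isBisection_iff.1 hA.1).1 y y.2 z z.2 (congrArg Subtype.val h))

theorem isBooleanGroupoid_of_isTopologicalBasis [T2Space G] [KBClosed G]
    (htop : IsTopologicalGroupoid G)
    (hbasis : IsTopologicalBasis {A : Set G | IsCompactOpenBisection A}) :
    IsBooleanGroupoid G := by
  refine ⟨inferInstance, isEtaleGroupoid htop hbasis, hbasis, inferInstance,
    isTopologicalBasis_of_isOpen_of_nhds (fun U hU => hU.1) fun x U hx hU => ?_⟩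
  -- Since the identities are open in `G`, an open set of identities is open in `G`, and a basic
  -- bisection inside it is already a compact-open set of identities.
  obtain ⟨A, hA, hxA, hAU⟩ := hbasis.exists_subset_of_mem_open (Set.mem_image_of_mem _ hx)
    ((isOpen_identities hbasis).isOpenMap_subtype_val U hU)
  refine ⟨Subtype.val ⁻¹' A, ⟨hA.2.1.preimage continuous_subtype_val,
    Subtype.isCompact_iff.2 ?_⟩, hxA, ?_⟩
  · rw [Subtype.image_preimage_coe, Set.inter_eq_right.2]
    · exact hA.2.2
    · exact hAU.trans (Subtype.coe_image_subset _ _)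
  · intro y hy
    obtain ⟨z, hz, hzy⟩ := hAU hy
    rwa [← Subtype.ext hzy]

end BooleanGroupoids

/-! ### Transport along isomorphisms of topological groupoids. -/

namespace GroupoidHomeomorph

variable {G H : Type u} [ArrowGroupoid G] [ArrowGroupoid H] [TopologicalSpace G]
  [TopologicalSpace H] (e : GroupoidHomeomorph G H)

/-- Preservation of inverses is not part of the structure. It follows because `e` sends `ran x` to a
left unit of `e x`, hence to an identity, and this identity is the product of `e x` and `e x⁻¹`. -/
theorem map_inv (x : G) : e.toHomeomorph x⁻¹ = (e.toHomeomorph x)⁻¹ := by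
  have h1 : Composable (e.toHomeomorph x) (e.toHomeomorph x⁻¹) :=
    (e.composable_iff _ _).1 (composable_inv x)
  have h2 : Composable (e.toHomeomorph (ran x)) (e.toHomeomorph x) :=
    (e.composable_iff _ _).1 (comp_assoc x x⁻¹ x (composable_inv x) (inv_composable x)).1
  have h3 : comp _ _ h2 = e.toHomeomorph x :=
    (e.map_comp _ _ ((e.composable_iff _ _).2 h2)).symm.trans
      (congrArg e.toHomeomorph (ran_comp' x _))
  have h4 : e.toHomeomorph (ran x) ∈ identities H := by
    obtain ⟨k, hk⟩ := comp_inv_cancel _ _ h2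
    refine ⟨e.toHomeomorph x, ?_⟩
    rw [← hk]
    exact comp_congr h3.symm rfl _ _
  have h5 : Composable (e.toHomeomorph x) ((e.toHomeomorph x⁻¹)⁻¹)⁻¹ := by
    rwa [inv_invol]
  have h6 : comp _ _ h5 ∈ identities H := by
    rw [comp_congr rfl (inv_invol _) h5 h1]
    have := e.map_comp _ _ (composable_inv x)
    exact this ▸ h4
  rw [eq_of_comp_inv_mem h5 h6, inv_invol]

theorem map_dom (x : G) : e.toHomeomorph (dom x) = dom (e.toHomeomorph x) :=
  (e.map_comp _ _ (inv_composable x)).trans (comp_congr (e.map_inv x) rfl _ _)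

theorem map_ran (x : G) : e.toHomeomorph (ran x) = ran (e.toHomeomorph x) :=
  (e.map_comp _ _ (composable_inv x)).trans (comp_congr rfl (e.map_inv x) _ _)

theorem preimage_setInv (A : Set H) :
    e.toHomeomorph ⁻¹' setInv A = setInv (e.toHomeomorph ⁻¹' A) := by
  ext x
  rw [Set.mem_preimage, mem_setInv, mem_setInv, Set.mem_preimage, map_inv]

theorem preimage_setMul (A B : Set H) : e.toHomeomorph ⁻¹' setMul A B =
    setMul (e.toHomeomorph ⁻¹' A) (e.toHomeomorph ⁻¹' B) := by
  ext z
  constructor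
  · rintro ⟨x, hx, y, hy, h, hz⟩
    obtain ⟨x, rfl⟩ := e.toHomeomorph.surjective x
    obtain ⟨y, rfl⟩ := e.toHomeomorph.surjective y
    have h' := (e.composable_iff x y).2 h
    exact ⟨x, hx, y, hy, h', e.toHomeomorph.injective ((e.map_comp x y h').trans hz)⟩
  · rintro ⟨x, hx, y, hy, h, rfl⟩
    exact ⟨_, hx, _, hy, (e.composable_iff x y).1 h, (e.map_comp x y h).symm⟩

theorem isCompactOpenBisection_preimage {A : Set H} :
    IsCompactOpenBisection (e.toHomeomorph ⁻¹' A) ↔ IsCompactOpenBisection A := by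
  refine and_congr ?_ (and_congr e.toHomeomorph.isOpen_preimage e.toHomeomorph.isCompact_preimage)
  rw [isBisection_iff, isBisection_iff]
  simp only [e.toHomeomorph.surjective.forall, Set.mem_preimage, ← map_dom, ← map_ran,
    e.toHomeomorph.injective.eq_iff]

theorem kbClosed (e : GroupoidHomeomorph G H) [KBClosed G] : KBClosed H where
  inv_mem A hA := by
    rw [← e.isCompactOpenBisection_preimage] at hA ⊢
    rw [preimage_setInv]
    exact KBClosed.inv_mem _ hA
  mul_mem A B hA hB := by
    rw [← e.isCompactOpenBisection_preimage] at hA hB ⊢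
    rw [preimage_setMul]
    exact KBClosed.mul_mem _ _ hA hB

theorem isTopologicalBasis (e : GroupoidHomeomorph G H)
    (h : IsTopologicalBasis {A : Set G | IsCompactOpenBisection A}) :
    IsTopologicalBasis {A : Set H | IsCompactOpenBisection A} := by
  refine isTopologicalBasis_of_isOpen_of_nhds (fun A hA => hA.2.1) fun y U hy hU => ?_
  obtain ⟨x, rfl⟩ := e.toHomeomorph.surjective y
  obtain ⟨A, hA, hxA, hAU⟩ := h.exists_subset_of_mem_open
    (u := e.toHomeomorph ⁻¹' U) hy (hU.preimage e.toHomeomorph.continuous)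
  refine ⟨e.toHomeomorph '' A, ?_, Set.mem_image_of_mem _ hxA, Set.image_subset_iff.2 hAU⟩
  rw [Set.mem_ofPred_eq, ← e.isCompactOpenBisection_preimage,
    Set.preimage_image_eq _ e.toHomeomorph.injective]
  exact hA

theorem isTopologicalGroupoid (e : GroupoidHomeomorph G H)
    (h : IsTopologicalGroupoid G) : IsTopologicalGroupoid H := by
  constructor
  · convert e.toHomeomorph.continuous.comp (h.1.comp e.toHomeomorph.symm.continuous) using 2 with y
    simp [map_inv]
  · have hc : ∀ p : {p : H × H // Composable p.1 p.2},
        Composable (e.toHomeomorph.symm p.1.1) (e.toHomeomorph.symm p.1.2) := fun p => by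
      refine (e.composable_iff _ _).2 ?_
      change Composable (e.toHomeomorph _) (e.toHomeomorph _)
      simpa using p.2
    have hf : Continuous fun p : {p : H × H // Composable p.1 p.2} =>
        (⟨(e.toHomeomorph.symm p.1.1, e.toHomeomorph.symm p.1.2), hc p⟩ :
          {p : G × G // Composable p.1 p.2}) := by
      refine Continuous.subtype_mk ?_ _
      fun_prop
    convert e.toHomeomorph.continuous.comp (h.2.comp hf) using 2 with p
    refine Eq.trans ?_ (e.map_comp _ _ (hc p)).symm
    exact comp_congr (e.toHomeomorph.apply_symm_apply _).symm
      (e.toHomeomorph.apply_symm_apply _).symm _ _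

end GroupoidHomeomorph

end NCStone

/-- First booleanization theorem. -/
theorem theorem5p6 {S : Type*} [InverseSemigroup S] :
    (Nonempty (GroupoidHomeomorph (UniversalGroupoid S) (WeakBooleanization (DSemigroup S))) ∧
      IsWeaklyBoolean (BSemigroup S) ∧
      Nonempty (GroupoidHomeomorph (UniversalGroupoid S) (PrimeFilter (BSemigroup S)))) ∧
    (WeakMeetCondition S →
      IsMeetSemigroup (DSemigroup S) ∧
      IsBooleanGroupoid (WeakBooleanization (DSemigroup S))) := by
  have htop : IsTopologicalGroupoid (UniversalGroupoid S) :=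
    UniversalGroupoid.isTopologicalGroupoid
  have hbasis := UniversalGroupoid.isTopologicalBasis (S := S)
  have e := DSemigroup.universalHomeomorph (S := S)
  refine ⟨⟨⟨e⟩, KB.isWeaklyBoolean htop, ⟨KB.pointHomeomorph hbasis htop⟩⟩, fun hS => ?_⟩
  -- Hausdorffness is proved for the universal groupoid and passed through `e` to the weak
  -- booleanization.
  have := UniversalGroupoid.t2Space hS
  have := e.toHomeomorph.t2Space
  have := e.kbClosed
  exact ⟨DSemigroup.isMeetSemigroup hS, isBooleanGroupoid_of_isTopologicalBasis
    (e.isTopologicalGroupoid htop) (e.isTopologicalBasis hbasis)⟩
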